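/- A qcb$_0$-space is a $T_0$-space that is a topological quotient of a countably based space; $\mathsf{QCB_0}$ is the category of qcb$_0$-spaces and continuous functions. Let $\mathcal N=\omega^\omega$ be the Baire space. An admissible representation of a space $X$ is a continuous surjection $\delta\colon D\to X$ from a subspace $D\subseteq\mathcal N$ such that every continuous $\nu\colon Z\to X$ with $Z\subseteq\mathcal N$ has the form $\nu=\delta\circ g$ for some continuous $g\colon Z\to D$; put $EQ(\delta)=\{(p,q)\in D\times D\mid \delta(p)=\delta(q)\}$. For a topological space $X$ let $\mathbf\Sigma^1_0(X)$ be the class of countable unions of differences of open subsets of $X$, and let $\mathbf\Sigma^1_{n+1}(X)$ be the class of all sets $\{x\in X\mid \exists p\in\mathcal N.\ (p,x)\notin B\}$ with $B\in\mathbf\Sigma^1_n(\mathcal N\times X)$. A qcb$_0$-space is projective if it has an admissible representation $\delta$ with $EQ(\delta)\in\mathbf\Sigma^1_n(\mathcal N\times\mathcal N)$ for some $n<\omega$; $\mathsf{QCB_0}(\mathbf P)$ is the full subcategory of $\mathsf{QCB_0}$ of projective qcb$_0$-spaces. A full subcategory $\mathsf C$ of $\mathsf{QCB_0}$ is said to inherit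 exponentials, finite limits and finite colimits from $\mathsf{QCB_0}$ if for any objects $X,Y$ of $\mathsf C$ some $\mathsf{QCB_0}$-exponential $Y^X$ is an object of $\mathsf C$, and $\mathsf C$ has all finite limits and finite colimits and the inclusion $\mathsf C\to\mathsf{QCB_0}$ preserves them. Theorem. Up to homeomorphism, $\mathsf{QCB_0}(\mathbf P)$ is the smallest full subcategory of $\mathsf{QCB_0}$ that inherits exponentials, finite limits and finite colimits from $\mathsf{QCB_0}$ and contains the Sierpinski space $\mathbb S$ and the discrete space $\omega$ of natural numbers. That is: 1. $\mathsf{QCB_0}(\mathbf P)$ is closed under homeomorphism, inherits exponentials, finite limits and finite colimits from $\mathsf{QCB_0}$, and contains $\mathbb S$ and $\omega$. 2. If $\mathsf C$ is a full subcategory of $\mathsf{QCB_0}$ that inherits exponentials, finite limits and finite colimits from $\mathsf{QCB_0}$ and contains homeomorphic copies of $\mathbb S$ and $\omega$, then every projective qcb$_0$-space is homeomorphic to an object of $\mathsf C$. -/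

import Mathlib

open CategoryTheory CategoryTheory.Limits

/-- A qcb₀-space: a T₀-space that is a topological quotient of a countably based space. -/
def IsQCB0Space (X : Type) [TopologicalSpace X] : Prop :=
  T0Space X ∧ ∃ (A : Type) (_ : TopologicalSpace A) (_ : SecondCountableTopology A) (f : A → X),
    Topology.IsQuotientMap f

/-- The qcb₀-spaces among all topological spaces. -/
def isQCB0 : ObjectProperty TopCat.{0} := fun X => IsQCB0Space X

/-- The category of qcb₀-spaces and continuous functions. -/
abbrev QCB0 : Type 1 := isQCB0.FullSubcategory

theorem isQCB0Space_of_secondCountable (X : Type) [TopologicalSpace X] [T0Space X]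
    [SecondCountableTopology X] : IsQCB0Space X :=
  ⟨inferInstance, X, inferInstance, inferInstance, id, Topology.IsQuotientMap.id⟩

/-- The Sierpinski space: `Prop`, whose open sets are `∅`, `{True}` and the whole space. -/
def sierpinskiQCB0 : QCB0 := ⟨TopCat.of Prop, isQCB0Space_of_secondCountable Prop⟩

/-- The discrete space `ω` of natural numbers. -/
def omegaQCB0 : QCB0 := ⟨TopCat.of ℕ, isQCB0Space_of_secondCountable ℕ⟩

/-- The Baire space, with the product of the discrete topologies. -/
abbrev Baire : Type := ℕ → ℕ

/-- The levels `Σ¹ₙ(X)`, `n < ω`, in an arbitrary space `X`. The zeroth level consists of the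
countable unions of differences of open sets; the level `n + 1` consists of the projections along
the Baire space of the complements of sets of level `n` in `Baire × X`. -/
def IsSigmaOne : ℕ → ∀ (X : Type) [TopologicalSpace X], Set X → Prop
  | 0, _, _, A => ∃ U V : ℕ → Set _, (∀ i, IsOpen (U i)) ∧ (∀ i, IsOpen (V i)) ∧
      A = ⋃ i, U i \ V i
  | n + 1, X, _, A => ∃ B : Set (Baire × X), IsSigmaOne n (Baire × X) B ∧
      A = {x | ∃ p : Baire, (p, x) ∈ Bᶜ}

/-- `δ`, defined on the subspace `D` of the Baire space, is an admissible representation of `X`: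
a continuous surjection through which every continuous function from a subspace of the Baire
space to `X` factors continuously. -/
structure IsAdmissibleRepresentation {X : Type} [TopologicalSpace X] {D : Set Baire}
    (δ : D → X) : Prop where
  surjective : Function.Surjective δ
  continuous : Continuous δ
  factors : ∀ (Z : Set Baire) (ν : Z → X), Continuous ν →
    ∃ g : Z → D, Continuous g ∧ ν = δ ∘ g

/-- `EQ(δ)`: the pairs of names in the domain of `δ` that name the same point. -/
def EQ {X : Type} {D : Set Baire} (δ : D → X) : Set (Baire × Baire) :=
  {r | ∃ (hp : r.1 ∈ D) (hq : r.2 ∈ D), δ ⟨r.1, hp⟩ = δ ⟨r.2, hq⟩}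

/-- The projective qcb₀-spaces: those that have, for some `n < ω`, an admissible
representation `δ` such that `EQ(δ)` is a `Σ¹ₙ`-set. -/
def projectiveQCB0 : ObjectProperty QCB0 := fun X =>
  ∃ (n : ℕ) (D : Set Baire) (δ : D → X.obj),
    IsAdmissibleRepresentation δ ∧ IsSigmaOne n (Baire × Baire) (EQ δ)

/-- In a category `C` with binary products, `E` is an exponential `Y ^ X`: there is an evaluation
morphism `E × X ⟶ Y` such that every morphism `Z × X ⟶ Y` is `ev ∘ (g × 𝟙)` for exactly one
`g : Z ⟶ E`. -/
def IsExponential {C : Type*} [Category C] (X Y E : C) : Prop :=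
  ∃ (c : BinaryFan E X) (hc : IsLimit c) (ev : c.pt ⟶ Y),
    ∀ (Z : C) (d : BinaryFan Z X) (_ : IsLimit d) (f : d.pt ⟶ Y),
      ∃! g : Z ⟶ E, hc.lift (BinaryFan.mk (d.fst ≫ g) d.snd) ≫ ev = f

/-- The full subcategory of `C` on the objects satisfying `P` inherits exponentials, finite limits
and finite colimits from `C`: it contains an exponential, formed in `C`, of any two of its objects,
and it has finite limits and finite colimits, which are finite limits and finite colimits in `C`.
It need not be closed under isomorphism. -/
structure InheritsFiniteStructure {C : Type*} [Category C] (P : ObjectProperty C) : Prop where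
  exponentials : ∀ X Y : C, P X → P Y → ∃ E : C, P E ∧ IsExponential X Y E
  hasFiniteLimits : HasFiniteLimits P.FullSubcategory
  preservesFiniteLimits : PreservesFiniteLimits P.ι
  hasFiniteColimits : HasFiniteColimits P.FullSubcategory
  preservesFiniteColimits : PreservesFiniteColimits P.ι

/-! ### Closure properties of the projective hierarchy -/

/-! Closure of the projective spaces under the operations rests on the fact that relations definable
from projective ones by connectives, quantifiers over the Baire space and continuous substitution
are projective. The spaces built here are presented on a set of names by a relation definable in
this way. Such a presentation is usually not admissible, but `IsProjectiveSpace.of_presentation`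
repairs this: a new name of a point codes the collection of all codes of its open neighbourhoods, so
that the space is embedded in its double dual over the Sierpinski space. Only quantifiers over the
Baire space are added, and admissibility follows from `continuous_eval_of_isQuotientMap`, by which
membership in a coded open set is jointly continuous when tested on first countable spaces.
Exponentials are presented by realizers, pullbacks by pairs of names, and pushouts by the relation
that generates the gluing.

For minimality, let a subcategory inherit the structure and contain the Sierpinski space and `ω`. It
contains the Baire space `ω ^ ω`. Open subspaces are pullbacks along maps to the Sierpinski space;
universal quantification is a pullback of exponentials (`cb_setOf_forall`); complements in Hausdorff
spaces arise by quantifying over an inequality (`cb_compl`); images are equalizers of cokernel pairs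
(`cb_range`). Hence every projective subset of a power of the Baire space lies in the subcategory,
up to homeomorphism and with its subspace topology. An admissible `δ` on a qcb₀-space is a quotient
map, so the space is the pushout of the two projections of `EQ δ` to the domain of `δ`. -/

theorem IsSigmaOne.preimage (n : ℕ) : ∀ {X Y : Type} [TopologicalSpace X] [TopologicalSpace Y]
    {f : X → Y} (_ : Continuous f) {A : Set Y}, IsSigmaOne n Y A → IsSigmaOne n X (f ⁻¹' A) := by
  induction n with
  | zero =>
    rintro X Y _ _ f hf A ⟨U, V, hU, hV, rfl⟩
    exact ⟨fun i => f ⁻¹' U i, fun i => f ⁻¹' V i, fun i => (hU i).preimage hf,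
      fun i => (hV i).preimage hf, by simp [Set.preimage_iUnion]⟩
  | succ n ih =>
    rintro X Y _ _ f hf A ⟨B, hB, rfl⟩
    exact ⟨_, ih (continuous_id.prodMap hf) hB, rfl⟩

theorem IsSigmaOne.succ (n : ℕ) : ∀ {X : Type} [TopologicalSpace X] {A : Set X},
    IsSigmaOne n X A → IsSigmaOne (n + 1) X A := by
  induction n with
  | zero =>
    rintro X _ A ⟨U, V, hU, hV, rfl⟩
    have hev : ∀ i : ℕ, IsOpen {t : Baire × X | t.1 0 = i} := fun i =>
      (isOpen_discrete {i}).preimage (f := fun t : Baire × X => t.1 0) (by fun_prop)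
    -- The entry `p 0` of the quantified sequence selects the index of the union. The complement of
    -- the selected difference splits into the points outside `U k`, put at index `2 * k`, and those
    -- in `V k`, put at `2 * k + 1`.
    refine ⟨{t | t.2 ∉ U (t.1 0) \ V (t.1 0)},
      ⟨fun i => if Even i then {t | t.1 0 = i / 2} else {t | t.1 0 = i / 2 ∧ t.2 ∈ V (i / 2)},
       fun i => if Even i then {t | t.2 ∈ U (i / 2)} else ∅, ?_, ?_, ?_⟩, ?_⟩
    · intro i
      dsimp only
      split_ifs
      · exact hev _
      · exact (hev _).inter ((hV _).preimage continuous_snd)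
    · intro i
      dsimp only
      split_ifs
      · exact (hU _).preimage continuous_snd
      · exact isOpen_empty
    · ext t
      simp only [Set.mem_ofPred_eq, Set.mem_iUnion, Set.mem_sdiff]
      constructor
      · intro h
        by_cases hu : t.2 ∈ U (t.1 0)
        · refine ⟨2 * t.1 0 + 1, ?_⟩
          have : (2 * t.1 0 + 1) / 2 = t.1 0 := by omega
          simp only [Nat.not_even_bit1, if_false, this]
          exact ⟨⟨rfl, by_contra fun hv => h ⟨hu, hv⟩⟩, by simp⟩
        · exact ⟨2 * t.1 0, by simp [hu]⟩
      · rintro ⟨i, h1, h2⟩ ⟨h3, h4⟩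
        split_ifs at h1 h2
        · rw [Set.mem_ofPred_eq] at h1 h2
          exact h2 (h1 ▸ h3)
        · exact h4 (h1.1 ▸ h1.2)
    · ext x
      simp only [Set.mem_iUnion, Set.mem_ofPred_eq, Set.mem_compl_iff, not_not]
      exact ⟨fun ⟨i, hi⟩ => ⟨fun _ => i, hi⟩, fun ⟨p, hp⟩ => ⟨_, hp⟩⟩
  | succ n ih =>
    rintro X _ A ⟨B, hB, rfl⟩
    exact ⟨B, ih hB, rfl⟩

theorem IsSigmaOne.mono {m n : ℕ} (h : m ≤ n) {X : Type} [TopologicalSpace X] {A : Set X}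
    (hA : IsSigmaOne m X A) : IsSigmaOne n X A := by
  induction h with
  | refl => exact hA
  | step _ ih => exact ih.succ

/-- The two claims need a joint induction, because the complement in the definition of the next
level interchanges them. For intersections, one sequence carries both witnesses on its even and odd
positions. -/
theorem IsSigmaOne.union_inter (n : ℕ) : ∀ {X : Type} [TopologicalSpace X] {A B : Set X},
    IsSigmaOne n X A → IsSigmaOne n X B → IsSigmaOne n X (A ∪ B) ∧ IsSigmaOne n X (A ∩ B) := by
  induction n with
  | zero =>
    rintro X _ A B ⟨U, V, hU, hV, rfl⟩ ⟨U', V', hU', hV', rfl⟩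
    refine ⟨⟨fun i => if Even i then U (i / 2) else U' (i / 2),
      fun i => if Even i then V (i / 2) else V' (i / 2), ?_, ?_, ?_⟩,
      ⟨fun i => U i.unpair.1 ∩ U' i.unpair.2, fun i => V i.unpair.1 ∪ V' i.unpair.2,
        fun i => (hU _).inter (hU' _), fun i => (hV _).union (hV' _), ?_⟩⟩
    · intro i
      dsimp only
      split_ifs
      exacts [hU _, hU' _]
    · intro i
      dsimp only
      split_ifs
      exacts [hV _, hV' _]
    · ext x
      simp only [Set.mem_union, Set.mem_iUnion]
      constructor
      · rintro (⟨i, hi⟩ | ⟨i, hi⟩)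
        · exact ⟨2 * i, by simpa using hi⟩
        · refine ⟨2 * i + 1, ?_⟩
          have : (2 * i + 1) / 2 = i := by omega
          simpa [this] using hi
      · rintro ⟨i, hi⟩
        split_ifs at hi
        exacts [Or.inl ⟨_, hi⟩, Or.inr ⟨_, hi⟩]
    · ext x
      simp only [Set.mem_inter_iff, Set.mem_iUnion, Set.mem_sdiff, Set.mem_union]
      constructor
      · rintro ⟨⟨i, hi⟩, ⟨j, hj⟩⟩
        exact ⟨Nat.pair i j, by simp [hi, hj]⟩
      · rintro ⟨i, hi⟩
        exact ⟨⟨i.unpair.1, by tauto⟩, ⟨i.unpair.2, by tauto⟩⟩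
  | succ n ih =>
    rintro X _ _ _ ⟨A, hA, rfl⟩ ⟨B, hB, rfl⟩
    have h₀ : Continuous fun t : Baire × X => ((fun i => t.1 (2 * i) : Baire), t.2) := by fun_prop
    have h₁ : Continuous fun t : Baire × X => ((fun i => t.1 (2 * i + 1) : Baire), t.2) := by
      fun_prop
    refine ⟨⟨_, (ih hA hB).2, ?_⟩, ⟨_, (ih (hA.preimage n h₀) (hB.preimage n h₁)).1, ?_⟩⟩
    · ext x
      simp only [Set.mem_union, Set.mem_ofPred_eq, Set.mem_compl_iff, Set.mem_inter_iff,
        not_and_or, exists_or]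
    · ext x
      simp only [Set.mem_union, Set.mem_ofPred_eq, Set.mem_compl_iff, Set.mem_inter_iff,
        not_or, Set.mem_preimage]
      constructor
      · rintro ⟨⟨p, hp⟩, ⟨q, hq⟩⟩
        refine ⟨fun i => if Even i then p (i / 2) else q (i / 2), ?_, ?_⟩
        · simpa using hp
        · have : ∀ i : ℕ, (2 * i + 1) / 2 = i := fun i => by omega
          simpa [this] using hq
      · rintro ⟨r, h⟩
        exact ⟨⟨_, h.1⟩, ⟨_, h.2⟩⟩

/-- A set on some level of the projective hierarchy. -/
def IsProjectiveSet {X : Type} [TopologicalSpace X] (A : Set X) : Prop := ∃ n, IsSigmaOne n X A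

namespace IsProjectiveSet

variable {X Y : Type} [TopologicalSpace X] [TopologicalSpace Y]

theorem of_isOpen {A : Set X} (hA : IsOpen A) : IsProjectiveSet A :=
  ⟨0, fun _ => A, fun _ => ∅, fun _ => hA, fun _ => isOpen_empty, by simp [Set.iUnion_const]⟩

theorem const (c : Prop) : IsProjectiveSet {_x : X | c} := of_isOpen isOpen_const

theorem comp {P : Y → Prop} (h : IsProjectiveSet {y | P y}) {f : X → Y} (hf : Continuous f) :
    IsProjectiveSet {x | P (f x)} := h.imp fun _ hn => hn.preimage _ hf

/-- A complement costs one level: it is a projection along a dummy variable. -/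
theorem not {P : X → Prop} (h : IsProjectiveSet {x | P x}) : IsProjectiveSet {x | ¬ P x} := by
  obtain ⟨n, hn⟩ := h
  exact ⟨n + 1, _, hn.preimage n (f := fun t : Baire × X => t.2) continuous_snd,
    by ext x; simp⟩

theorem ex {P : Baire → X → Prop} (h : IsProjectiveSet {t : Baire × X | P t.1 t.2}) :
    IsProjectiveSet {x | ∃ p, P p x} := by
  obtain ⟨n, hn⟩ := h.not
  exact ⟨n + 1, _, hn, by ext x; simp⟩

theorem and {P Q : X → Prop} (hP : IsProjectiveSet {x | P x}) (hQ : IsProjectiveSet {x | Q x}) :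
    IsProjectiveSet {x | P x ∧ Q x} := by
  obtain ⟨m, hm⟩ := hP
  obtain ⟨n, hn⟩ := hQ
  exact ⟨max m n,
    (IsSigmaOne.union_inter _ (hm.mono (le_max_left m n)) (hn.mono (le_max_right m n))).2⟩

theorem or {P Q : X → Prop} (hP : IsProjectiveSet {x | P x}) (hQ : IsProjectiveSet {x | Q x}) :
    IsProjectiveSet {x | P x ∨ Q x} := by
  simpa only [not_and_or, not_not] using (hP.not.and hQ.not).not

theorem imp {P Q : X → Prop} (hP : IsProjectiveSet {x | P x}) (hQ : IsProjectiveSet {x | Q x}) :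
    IsProjectiveSet {x | P x → Q x} := by
  simpa only [imp_iff_not_or] using hP.not.or hQ

theorem iff {P Q : X → Prop} (hP : IsProjectiveSet {x | P x}) (hQ : IsProjectiveSet {x | Q x}) :
    IsProjectiveSet {x | P x ↔ Q x} := by
  simpa only [iff_iff_implies_and_implies] using (hP.imp hQ).and (hQ.imp hP)

theorem all {P : Baire → X → Prop} (h : IsProjectiveSet {t : Baire × X | P t.1 t.2}) :
    IsProjectiveSet {x | ∀ p, P p x} := by
  simpa only [not_exists, not_not] using (IsProjectiveSet.ex (P := fun p x => ¬ P p x) h.not).not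

theorem all_nat {P : ℕ → X → Prop} (h : IsProjectiveSet {t : ℕ × X | P t.1 t.2}) :
    IsProjectiveSet {x | ∀ n, P n x} := by
  have h' : IsProjectiveSet {t : Baire × X | P (t.1 0) t.2} :=
    h.comp (f := fun t : Baire × X => (t.1 0, t.2)) (by fun_prop)
  have e : {x | ∀ n, P n x} = {x | ∀ p : Baire, P (p 0) x} := by
    ext x
    exact ⟨fun H p => H _, fun H n => H fun _ => n⟩
  rw [e]
  exact h'.all

end IsProjectiveSet

/-! ### Codes for open sets of the Baire space -/

theorem exists_clopen_basis_baire : ∃ B : ℕ → Set Baire, (∀ n, IsClopen (B n)) ∧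
    ∀ (U : Set Baire), IsOpen U → ∀ x ∈ U, ∃ n, x ∈ B n ∧ B n ⊆ U := by
  obtain ⟨e, he⟩ := exists_surjective_nat (List ℕ)
  refine ⟨fun n => ⋂ i : Fin (e n).length, {x | x i = (e n).get i}, fun n =>
    isClopen_iInter_of_finite fun i =>
      (isClopen_discrete {(e n).get i}).preimage (continuous_apply (i : ℕ)), ?_⟩
  intro U hU x hx
  obtain ⟨I, u, hu, hIU⟩ := isOpen_pi_iff.1 hU x hx
  obtain ⟨k, hk⟩ : ∃ k, ∀ i ∈ I, i < k := ⟨I.sup id + 1, fun i hi =>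
    Nat.lt_succ_of_le (Finset.le_sup (f := id) hi)⟩
  obtain ⟨n, hn⟩ := he (List.ofFn fun i : Fin k => x i)
  have hB : ∀ y : Baire, (y ∈ ⋂ i : Fin (e n).length, {x : Baire | x i = (e n).get i}) ↔
      ∀ i < k, y i = x i := by
    intro y
    simp only [Set.mem_iInter, Set.mem_ofPred_eq]
    constructor
    · intro H i hi
      have := H ⟨i, by simpa [hn] using hi⟩
      simpa [hn] using this
    · intro H i
      have := H i (by simpa [hn] using i.2)
      simpa [hn] using this
  refine ⟨n, (hB x).2 fun _ _ => rfl, fun y hy => hIU fun i hi => ?_⟩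
  rw [(hB y).1 hy i (hk i hi)]
  exact (hu i hi).2

/-- A countable base of clopen sets of the Baire space. -/
noncomputable def clopenBase : ℕ → Set Baire := exists_clopen_basis_baire.choose

theorem isClopen_clopenBase (n : ℕ) : IsClopen (clopenBase n) :=
  exists_clopen_basis_baire.choose_spec.1 n

theorem exists_clopenBase_subset {U : Set Baire} (hU : IsOpen U) {x : Baire} (hx : x ∈ U) :
    ∃ n, x ∈ clopenBase n ∧ clopenBase n ⊆ U :=
  exists_clopen_basis_baire.choose_spec.2 U hU x hx

/-- Membership of `x` in the open set coded by `p`. -/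
def CodeMem (p x : Baire) : Prop := ∃ m, p m ≠ 0 ∧ x ∈ clopenBase m.unpair.2

theorem isOpen_codeMem : IsOpen {t : Baire × Baire | CodeMem t.1 t.2} := by
  simp only [CodeMem, Set.ofPred_exists]
  refine isOpen_iUnion fun m => IsOpen.inter ?_ ?_
  · exact (isOpen_discrete {0}ᶜ).preimage ((continuous_apply m).comp continuous_fst)
  · exact (isClopen_clopenBase _).isOpen.preimage continuous_snd

/-- The code of the section at `z` marks the pair `(i, j)` when `z` lies in the `i`-th basic set and
the `i`-th by `j`-th box lies in `O`. Each entry depends on `z` only through a clopen set, hence `h`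
is continuous. The first component of the pair, ignored by `CodeMem`, makes room for this test. -/
theorem exists_code_curry {Z D : Set Baire} {O : Set (Z × D)} (hO : IsOpen O) :
    ∃ h : Z → Baire, Continuous h ∧ ∀ z (x : D), CodeMem (h z) x ↔ (z, x) ∈ O := by
  classical
  refine ⟨fun z m => if (z : Baire) ∈ clopenBase m.unpair.1 ∧
    (∀ (z' : Z) (x : D), (z' : Baire) ∈ clopenBase m.unpair.1 →
      (x : Baire) ∈ clopenBase m.unpair.2 → (z', x) ∈ O) then 1 else 0, ?_, ?_⟩
  · refine continuous_pi fun m => ?_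
    by_cases H : ∀ (z' : Z) (x : D), (z' : Baire) ∈ clopenBase m.unpair.1 →
      (x : Baire) ∈ clopenBase m.unpair.2 → (z', x) ∈ O
    · simp only [eq_true H, and_true]
      refine continuous_const.if (fun a ha => ?_) continuous_const
      have := ((isClopen_clopenBase m.unpair.1).preimage
        (continuous_subtype_val (p := (· ∈ Z)))).frontier_eq
      exact absurd ha (by rw [show {x : Z | (x : Baire) ∈ clopenBase m.unpair.1} =
        Subtype.val ⁻¹' clopenBase m.unpair.1 from rfl, this]; simp)
    · simp only [eq_false H, and_false, if_false]
      exact continuous_const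
  · intro z x
    constructor
    · rintro ⟨m, hm, hx⟩
      simp only [ne_eq, ite_eq_right_iff, one_ne_zero, imp_false, not_not] at hm
      exact hm.2 z x hm.1 hx
    · intro h
      obtain ⟨u, v, hu, hv, hz, hx, huv⟩ := isOpen_prod_iff.1 hO z x h
      obtain ⟨u', hu', rfl⟩ := isOpen_induced_iff.1 hu
      obtain ⟨v', hv', rfl⟩ := isOpen_induced_iff.1 hv
      obtain ⟨i, hi, hi'⟩ := exists_clopenBase_subset hu' hz
      obtain ⟨j, hj, hj'⟩ := exists_clopenBase_subset hv' hx
      refine ⟨Nat.pair i j, ?_, by simpa using hj⟩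
      simp only [Nat.unpair_pair, ne_eq, ite_eq_right_iff, one_ne_zero, imp_false, not_not]
      exact ⟨hi, fun z' x' h1 h2 => huv ⟨hi' h1, hj' h2⟩⟩

theorem exists_code {D : Set Baire} {U : Set D} (hU : IsOpen U) :
    ∃ p, ∀ x : D, CodeMem p x ↔ x ∈ U := by
  obtain ⟨h, -, hh⟩ := exists_code_curry (Z := Set.univ) (hU.preimage continuous_snd)
  exact ⟨h ⟨0, trivial⟩, fun x => hh _ x⟩

/-! ### Sequences in function spaces -/

/-- A product of a quotient map with `W` need not be a quotient map, so joint continuity does not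
simply descend. But sequences suffice on `Z × W`, and a convergent sequence in `W` with its limit is
compact; by the tube lemma, applied upstairs on `A`, the points of `E` that send a compact set into
an open set form an open set. -/
theorem continuous_eval_of_isQuotientMap {A E W Y Z : Type*} [TopologicalSpace A]
    [TopologicalSpace E] [TopologicalSpace W] [TopologicalSpace Y] [TopologicalSpace Z]
    [FirstCountableTopology W] [FirstCountableTopology Z] {q : A → E}
    (hq : Topology.IsQuotientMap q) {φ : E → W → Y}
    (hφ : Continuous fun t : A × W => φ (q t.1) t.2) {ν : Z → E} (hν : Continuous ν) :
    Continuous fun t : Z × W => φ (ν t.1) t.2 := by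
  have hw : ∀ e, Continuous (φ e) := fun e => by
    obtain ⟨a, rfl⟩ := hq.surjective e
    exact hφ.comp (Continuous.prodMk_right a)
  have key : ∀ (K : Set W) (V : Set Y), IsCompact K → IsOpen V →
      IsOpen {e | ∀ w ∈ K, φ e w ∈ V} := by
    intro K V hK hV
    rw [← hq.isOpen_preimage, isOpen_iff_mem_nhds]
    intro a ha
    obtain ⟨u, v, hu, -, hau, hKv, huv⟩ := generalized_tube_lemma (s := {a}) isCompact_singleton hK
      (hV.preimage hφ) (by rintro ⟨a', w⟩ ⟨rfl, hw⟩; exact ha w hw)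
    exact Filter.mem_of_superset (hu.mem_nhds (hau rfl)) fun a' ha' w hw =>
      huv (show (a', w) ∈ u ×ˢ v from ⟨ha', hKv hw⟩)
  refine continuous_iff_seqContinuous.2 fun s l hs => ?_
  obtain ⟨z, w⟩ := l
  rw [Prod.tendsto_iff] at hs
  refine tendsto_nhds.2 fun V hV hl => ?_
  have h1 : ∀ᶠ n in Filter.atTop, φ (ν z) (s n).2 ∈ V :=
    ((hw (ν z)).tendsto w).comp hs.2 (hV.mem_nhds hl)
  -- Dropping the terms before `N` makes `φ (ν z)` send the whole compact set into `V`.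
  obtain ⟨N, hN⟩ := Filter.eventually_atTop.1 h1
  have hK : IsCompact (insert w (Set.range fun n => (s (n + N)).2)) :=
    (hs.2.comp (Filter.tendsto_add_atTop_nat N)).isCompact_insert_range
  have hz : ν z ∈ {e | ∀ w' ∈ insert w (Set.range fun n => (s (n + N)).2), φ e w' ∈ V} := by
    rintro _ (rfl | ⟨n, rfl⟩)
    exacts [hl, hN _ (by omega)]
  have h2 : ∀ᶠ n in Filter.atTop, ν (s n).1 ∈ _ :=
    (hν.tendsto z).comp hs.1 ((key _ V hK hV).mem_nhds hz)
  filter_upwards [h2, Filter.eventually_ge_atTop N] with n hn hNn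
  exact hn _ (Or.inr ⟨n - N, by simp [Nat.sub_add_cancel hNn]⟩)

/-! ### Admissible representations of qcb₀-spaces -/

theorem IsQCB0Space.of_isQuotientMap {X A : Type} [TopologicalSpace X] [T0Space X]
    [TopologicalSpace A] [SecondCountableTopology A] {f : A → X}
    (hf : Topology.IsQuotientMap f) : IsQCB0Space X :=
  ⟨inferInstance, A, inferInstance, inferInstance, f, hf⟩

/-- A name of `a` enumerates basic sets that form a neighbourhood base at `a`. Points with a common
name are inseparable, so `f` identifies them, `X` being `T₀`. A finite prefix of a name extends to a
name of any point of the finite intersection it describes, which makes the naming map a quotient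
map. -/
theorem IsQCB0Space.exists_isQuotientMap {X : Type} [TopologicalSpace X] (hX : IsQCB0Space X) :
    ∃ (D : Set Baire) (π : D → X), Topology.IsQuotientMap π := by
  obtain ⟨_, A, _, _, f, hf⟩ := hX
  obtain ⟨b, hbc, -, hb⟩ := TopologicalSpace.exists_countable_basis A
  obtain ⟨B, hB⟩ := (hbc.insert Set.univ).exists_eq_range (Set.insert_nonempty _ _)
  have hBo : ∀ i, IsOpen (B i) := fun i => by
    rcases (hB ▸ Set.mem_range_self i : B i ∈ insert Set.univ b) with h | h
    · exact h ▸ isOpen_univ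
    · exact hb.isOpen h
  have hBs : ∀ a U, IsOpen U → a ∈ U → ∃ i, a ∈ B i ∧ B i ⊆ U := fun a U hU ha => by
    obtain ⟨v, hv, hav, hvU⟩ := hb.exists_subset_of_mem_open ha hU
    obtain ⟨i, rfl⟩ : v ∈ Set.range B := hB ▸ Or.inr hv
    exact ⟨i, hav, hvU⟩
  let N : A → Baire → Prop := fun a p => (∀ i, a ∈ B (p i)) ∧
    ∀ U, IsOpen U → a ∈ U → ∃ i, B (p i) ⊆ U
  have hname : ∀ a (p : Baire) (k : ℕ), (∀ i < k, a ∈ B (p i)) → ∃ p', (∀ i < k, p' i = p i) ∧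
      N a p' := by
    intro a p k hp
    classical
    obtain ⟨i₀, hi₀, -⟩ := hBs a Set.univ isOpen_univ trivial
    refine ⟨fun i => if i < k then p i else if a ∈ B (i - k) then i - k else i₀,
      fun i hi => if_pos hi, fun i => ?_, fun U hU ha => ?_⟩
    · dsimp only
      split_ifs with h1 h2
      exacts [hp i h1, h2, hi₀]
    · obtain ⟨j, hj, hjU⟩ := hBs a U hU ha
      exact ⟨j + k, by simpa [hj] using hjU⟩
  have huniq : ∀ a a' p, N a p → N a' p → f a = f a' := fun a a' p h h' => by
    refine Inseparable.eq (Inseparable.map ?_ hf.continuous)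
    refine inseparable_iff_forall_isOpen.2 fun U hU => ⟨fun ha => ?_, fun ha => ?_⟩
    · obtain ⟨i, hi⟩ := h.2 U hU ha
      exact hi (h'.1 i)
    · obtain ⟨i, hi⟩ := h'.2 U hU ha
      exact hi (h.1 i)
  choose g hg using fun p : {p | ∃ a, N a p} => p.2
  have hπ : ∀ (p : {p | ∃ a, N a p}) a, N a p → f (g p) = f a := fun p a h => huniq _ _ _ (hg p) h
  have hopen : ∀ (p : Baire) k, IsOpen {q : Baire | ∀ i < k, q i = p i} := fun p k => by
    have : {q : Baire | ∀ i < k, q i = p i} = ⋂ i ∈ Set.Iio k, (fun q : Baire => q i) ⁻¹' {p i} := by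
      ext; simp
    rw [this]
    exact (Set.finite_Iio k).isOpen_biInter fun i _ =>
      (isOpen_discrete _).preimage (continuous_apply i)
  refine ⟨{p | ∃ a, N a p}, fun p => f (g p), (Topology.isQuotientMap_iff _).2
    ⟨Topology.isCoinducing_iff.2 fun V => ⟨fun hV => ?_, fun hV => ?_⟩, fun x => ?_⟩⟩
  · rw [← hf.isOpen_preimage, isOpen_iff_mem_nhds]
    intro a ha
    obtain ⟨p, -, hp⟩ := hname a 0 0 (by simp)
    obtain ⟨O, hO, hOV⟩ := isOpen_induced_iff.1 hV
    have hpO : p ∈ O := by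
      have : (⟨p, a, hp⟩ : {p | ∃ a, N a p}) ∈ Subtype.val ⁻¹' O := by
        rw [hOV]
        show f (g _) ∈ V
        rw [hπ _ _ hp]
        exact ha
      exact this
    obtain ⟨I, u, hu, hsub⟩ := isOpen_pi_iff.1 hO p hpO
    obtain ⟨k, hk⟩ : ∃ k, ∀ i ∈ I, i < k := ⟨I.sup id + 1, fun i hi =>
      Nat.lt_succ_of_le (Finset.le_sup (f := id) hi)⟩
    have hU : IsOpen (⋂ i ∈ Set.Iio k, B (p i)) :=
      (Set.finite_Iio k).isOpen_biInter fun i _ => hBo _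
    refine Filter.mem_of_superset (hU.mem_nhds (by simpa using fun i _ => hp.1 i)) fun a' ha' => ?_
    obtain ⟨p', hp', hN⟩ := hname a' p k (by simpa using ha')
    have : (⟨p', a', hN⟩ : {p | ∃ a, N a p}) ∈ Subtype.val ⁻¹' O :=
      hsub fun i hi => by
        show p' i ∈ u i
        exact hp' i (hk i hi) ▸ (hu i hi).2
    rw [hOV] at this
    show f a' ∈ V
    exact (hπ ⟨p', a', hN⟩ a' hN) ▸ (this : f (g _) ∈ V)
  · refine isOpen_iff_mem_nhds.2 fun p hp => ?_
    obtain ⟨i, hi⟩ := (hg p).2 _ (hV.preimage hf.continuous) hp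
    refine Filter.mem_of_superset (((hopen p (i + 1)).preimage continuous_subtype_val).mem_nhds
      fun _ _ => rfl) fun q hq => ?_
    exact hi (hq i (Nat.lt_succ_self i) ▸ (hg q).1 i)
  · obtain ⟨a, rfl⟩ := hf.surjective x
    obtain ⟨p, -, hp⟩ := hname a 0 0 (by simp)
    exact ⟨⟨p, a, hp⟩, hπ _ _ hp⟩

/-- Some quotient map from a subspace of the Baire space factors through `δ`. -/
theorem IsAdmissibleRepresentation.isQuotientMap {X : Type} [TopologicalSpace X]
    (hX : IsQCB0Space X) {D : Set Baire} {δ : D → X} (hδ : IsAdmissibleRepresentation δ) :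
    Topology.IsQuotientMap δ := by
  obtain ⟨Z, π, hπ⟩ := hX.exists_isQuotientMap
  obtain ⟨g, hg, rfl⟩ := hδ.factors Z π hπ.continuous
  exact Topology.IsQuotientMap.of_comp hg hδ.continuous hπ

/-- A qcb₀-space with an admissible representation whose equivalence is a projective set. -/
def IsProjectiveSpace (X : Type) [TopologicalSpace X] : Prop :=
  IsQCB0Space X ∧ ∃ (D : Set Baire) (δ : D → X), IsAdmissibleRepresentation δ ∧
    IsProjectiveSet (EQ δ)

theorem continuous_codeMem {A : Type*} [TopologicalSpace A] {f g : A → Baire} (hf : Continuous f)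
    (hg : Continuous g) : Continuous fun a => CodeMem (f a) (g a) :=
  continuous_Prop.2 (isOpen_codeMem.preimage (hf.prodMk hg))

theorem isProjectiveSet_codeMem {X : Type} [TopologicalSpace X] {f g : X → Baire}
    (hf : Continuous f) (hg : Continuous g) : IsProjectiveSet {x | CodeMem (f x) (g x)} :=
  .of_isOpen (continuous_Prop.1 (continuous_codeMem hf hg))

/-- A `T₀`-space that is presented as the `T₀`-quotient of a projective subset of the Baire space
by a projective relation is a projective qcb₀-space. -/
theorem IsProjectiveSpace.of_presentation {X : Type} [TopologicalSpace X] [T0Space X]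
    {D : Set Baire} {π : D → X} (hπ : Continuous π) (hs : Function.Surjective π)
    {R : Baire → Baire → Prop} (hR : ∀ x y : D, R x y → π x = π y)
    (hdesc : ∀ χ : D → Prop, Continuous χ → (∀ x y : D, R x y → (χ x ↔ χ y)) →
      ∃ χ' : X → Prop, Continuous χ' ∧ ∀ x, χ x ↔ χ' (π x))
    (hDp : IsProjectiveSet D) (hRp : IsProjectiveSet {t : Baire × Baire | R t.1 t.2}) :
    IsProjectiveSpace X := by
  have hq : Topology.IsQuotientMap π := by
    refine (Topology.isQuotientMap_iff _).2 ⟨Topology.isCoinducing_iff.2 fun V =>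
      ⟨fun hV => ?_, fun hV => hV.preimage hπ⟩, hs⟩
    obtain ⟨χ', hχ', h⟩ := hdesc (fun x => π x ∈ V) (continuous_Prop.2 hV)
      fun x y hxy => by rw [hR x y hxy]
    convert continuous_Prop.1 hχ' using 1
    ext y
    obtain ⟨x, rfl⟩ := hs y
    exact h x
  -- These are the codes of the `R`-invariant open sets of names, that is, of the open subsets of
  -- `X`.
  let Inv : Baire → Prop := fun p => ∀ x y, x ∈ D → y ∈ D → R x y → (CodeMem p x ↔ CodeMem p y)
  have hV : ∀ p : {p | Inv p}, ∃ χ' : X → Prop, Continuous χ' ∧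
      ∀ x : D, CodeMem p x ↔ χ' (π x) := fun p =>
    hdesc (fun x => CodeMem p x) (continuous_codeMem continuous_const continuous_subtype_val)
      fun x y h => p.2 x y x.2 y.2 h
  choose V hVc hVm using hV
  have hopen : ∀ U : Set X, IsOpen U → ∃ p : {p | Inv p}, ∀ x, V p x ↔ x ∈ U := by
    intro U hU
    obtain ⟨p, hp⟩ := exists_code (hU.preimage hπ)
    refine ⟨⟨p, fun x y hx hy h => ?_⟩, fun x => ?_⟩
    · rw [hp ⟨x, hx⟩, hp ⟨y, hy⟩, Set.mem_preimage, Set.mem_preimage, hR ⟨x, hx⟩ ⟨y, hy⟩ h]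
    · obtain ⟨x, rfl⟩ := hs x
      rw [← hVm]
      exact hp x
  -- As a code, `r` selects among the invariant codes exactly those of the open sets around the
  -- point of `x`. Since `X` is `T₀`, this determines the point.
  let N : Baire → Baire → Prop := fun r x => x ∈ D ∧ ∀ p, Inv p → (CodeMem r p ↔ CodeMem p x)
  have hN : ∀ r (x y : D), N r x → (N r y ↔ π y = π x) := by
    intro r x y h
    constructor
    · intro h'
      refine Inseparable.eq (inseparable_iff_forall_isOpen.2 fun U hU => ?_)
      obtain ⟨p, hp⟩ := hopen U hU
      rw [← hp, ← hp, ← hVm, ← hVm, ← h.2 p p.2, ← h'.2 p p.2]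
    · intro e
      refine ⟨y.2, fun p hp => ?_⟩
      rw [h.2 p hp, hVm ⟨p, hp⟩, hVm ⟨p, hp⟩, e]
  have hNp : IsProjectiveSet {t : Baire × Baire | N t.2 t.1} := by
    refine (hDp.comp (P := (· ∈ D)) continuous_fst).and (IsProjectiveSet.all
      (P := fun p (t : Baire × Baire) => Inv p → (CodeMem t.2 p ↔ CodeMem p t.1))
      (IsProjectiveSet.imp ?_ ((isProjectiveSet_codeMem (by fun_prop) (by fun_prop)).iff
        (isProjectiveSet_codeMem (by fun_prop) (by fun_prop)))))
    refine IsProjectiveSet.all (P := fun x (t : Baire × Baire × Baire) => ∀ y, x ∈ D → y ∈ D →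
      R x y → (CodeMem t.1 x ↔ CodeMem t.1 y)) (IsProjectiveSet.all
      (P := fun y (t : Baire × Baire × Baire × Baire) => t.1 ∈ D → y ∈ D →
      R t.1 y → (CodeMem t.2.1 t.1 ↔ CodeMem t.2.1 y)) ?_)
    exact (hDp.comp (P := (· ∈ D)) (by fun_prop)).imp
      ((hDp.comp (P := (· ∈ D)) (by fun_prop)).imp
      ((hRp.comp (P := fun t => R t.1 t.2)
        (f := fun t : Baire × Baire × Baire × Baire × Baire => (t.2.1, t.1)) (by fun_prop)).imp
      ((isProjectiveSet_codeMem (by fun_prop) (by fun_prop)).iff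
        (isProjectiveSet_codeMem (by fun_prop) (by fun_prop)))))
  choose g hg using fun r : {r | ∃ x, N r x} => r.2
  let δ : {r | ∃ x, N r x} → X := fun r => π ⟨g r, (hg r).1⟩
  have hδ : ∀ (r : {r | ∃ x, N r x}) (x : D), N r x ↔ π x = δ r := fun r x =>
    hN r ⟨g r, (hg r).1⟩ x (hg r)
  refine ⟨.of_isQuotientMap hq, _, δ, ⟨?_, ?_, ?_⟩, ?_⟩
  · intro x
    obtain ⟨x, rfl⟩ := hs x
    obtain ⟨r, hr⟩ := exists_code (D := {p | Inv p}) (U := {p | CodeMem p x})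
      (continuous_Prop.1 (continuous_codeMem continuous_subtype_val continuous_const))
    have : N r x := ⟨x.2, fun p hp => hr ⟨p, hp⟩⟩
    exact ⟨⟨r, x, this⟩, ((hδ ⟨r, x, this⟩ x).1 this).symm⟩
  · refine continuous_def.2 fun U hU => ?_
    obtain ⟨p, hp⟩ := hopen U hU
    have : δ ⁻¹' U = {r : {r | ∃ x, N r x} | CodeMem r p} := by
      ext r
      rw [Set.mem_preimage, ← hp, ← hVm]
      exact ((hg r).2 p p.2).symm
    rw [this]
    exact continuous_Prop.1 (continuous_codeMem continuous_subtype_val continuous_const)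
  · intro Z ν hν
    have hφ : Continuous fun t : D × {p | Inv p} => V t.2 (π t.1) := by
      simp only [← hVm]
      exact continuous_codeMem (by fun_prop) (by fun_prop)
    -- Membership of `ν z` in the open set coded by `p` is jointly continuous in `z` and `p`;
    -- currying it yields new names of `ν z` that depend continuously on `z`.
    have h2 := continuous_eval_of_isQuotientMap (φ := fun x p => V p x) hq hφ hν
    obtain ⟨h, hh, hm⟩ := exists_code_curry (continuous_Prop.1 h2)
    have key : ∀ z (x : D), π x = ν z → N (h z) x := fun z x e =>
      ⟨x.2, fun p hp => (hm z ⟨p, hp⟩).trans (by rw [hVm ⟨p, hp⟩, e]; rfl)⟩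
    refine ⟨fun z => ⟨h z, _, key z (hs (ν z)).choose (hs (ν z)).choose_spec⟩,
      hh.subtype_mk _, funext fun z => ?_⟩
    exact (hs (ν z)).choose_spec.symm.trans
      ((hδ ⟨h z, _⟩ _).1 (key z (hs (ν z)).choose (hs (ν z)).choose_spec))
  · have : EQ δ = {t | ∃ x, N t.1 x ∧ N t.2 x} := by
      ext t
      constructor
      · rintro ⟨⟨x, hx⟩, ⟨y, hy⟩, e⟩
        refine ⟨x, hx, ?_⟩
        have := (hδ ⟨t.1, x, hx⟩ ⟨x, hx.1⟩).1 hx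
        exact (hδ ⟨t.2, y, hy⟩ ⟨x, hx.1⟩).2 (this.trans e)
      · rintro ⟨x, hx, hy⟩
        exact ⟨⟨x, hx⟩, ⟨x, hy⟩, ((hδ ⟨t.1, x, hx⟩ ⟨x, hx.1⟩).1 hx).symm.trans
          ((hδ ⟨t.2, x, hy⟩ ⟨x, hx.1⟩).1 hy)⟩
    rw [this]
    exact IsProjectiveSet.ex (P := fun x (t : Baire × Baire) => N t.1 x ∧ N t.2 x)
      ((hNp.comp (P := fun t => N t.2 t.1) (f := fun t : Baire × Baire × Baire => (t.1, t.2.1))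
        (by fun_prop)).and (hNp.comp (P := fun t => N t.2 t.1)
        (f := fun t : Baire × Baire × Baire => (t.1, t.2.2)) (by fun_prop)))

/-- A `T₀`-space that is a quotient of a projective subset of the Baire space with a projective
kernel is a projective qcb₀-space. -/
theorem IsProjectiveSpace.of_isQuotientMap {X : Type} [TopologicalSpace X] [T0Space X]
    {D : Set Baire} {π : D → X} (hq : Topology.IsQuotientMap π) (h : IsProjectiveSet (EQ π)) :
    IsProjectiveSpace X := by
  refine .of_presentation hq.continuous hq.surjective (R := fun x y => (x, y) ∈ EQ π)
    (fun x y ⟨_, _, e⟩ => e) (fun χ hχ hinv => ?_) ?_ h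
  · refine ⟨fun y => ∃ x, π x = y ∧ χ x, continuous_Prop.2 (hq.isOpen_preimage.1 ?_), ?_⟩
    · convert continuous_Prop.1 hχ using 1
      ext x
      exact ⟨fun ⟨y, e, hy⟩ => (hinv y x ⟨y.2, x.2, e⟩).1 hy, fun hx => ⟨x, rfl, hx⟩⟩
    · exact fun x => ⟨fun hx => ⟨x, rfl, hx⟩, fun ⟨y, e, hy⟩ => (hinv y x ⟨y.2, x.2, e⟩).1 hy⟩
  · convert h.comp (P := (· ∈ EQ π)) (f := fun x : Baire => (x, x)) (by fun_prop) using 1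
    ext x
    exact ⟨fun hx => ⟨hx, hx, rfl⟩, fun ⟨hx, _⟩ => hx⟩

/-! ### Names of pairs and of functions -/

def Baire.evens (p : Baire) : Baire := fun i => p (2 * i)

def Baire.odds (p : Baire) : Baire := fun i => p (2 * i + 1)

def Baire.interleave (p q : Baire) : Baire := fun i => if Even i then p (i / 2) else q (i / 2)

@[simp] theorem Baire.evens_interleave (p q : Baire) : (p.interleave q).evens = p := by
  ext i; simp [Baire.evens, Baire.interleave]

@[simp] theorem Baire.odds_interleave (p q : Baire) : (p.interleave q).odds = q := by
  ext i
  have : (2 * i + 1) / 2 = i := by omega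
  simp [Baire.odds, Baire.interleave, this]

@[fun_prop] theorem Baire.continuous_evens : Continuous Baire.evens := by
  unfold Baire.evens; fun_prop

@[fun_prop] theorem Baire.continuous_odds : Continuous Baire.odds := by
  unfold Baire.odds; fun_prop

theorem Baire.continuous_interleave : Continuous fun t : Baire × Baire => t.1.interleave t.2 := by
  refine continuous_pi fun i => ?_
  unfold Baire.interleave
  split_ifs <;> fun_prop

/-- Prepend a number to a sequence. -/
def Baire.cons (n : ℕ) (x : Baire) : Baire
  | 0 => n
  | i + 1 => x i

theorem Baire.continuous_cons : Continuous fun t : ℕ × Baire => Baire.cons t.1 t.2 := by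
  refine continuous_pi fun i => ?_
  cases i with
  | zero => exact continuous_fst
  | succ i => exact (continuous_apply i).comp continuous_snd

/-- The partial function coded by `p` takes the value `y` at `x`. -/
def RealizesAt (p x y : Baire) : Prop := ∀ n v, CodeMem p (.cons n (.cons v x)) ↔ y n = v

theorem RealizesAt.unique {p x y y' : Baire} (h : RealizesAt p x y) (h' : RealizesAt p x y') :
    y = y' := funext fun n => (h n (y' n)).1 ((h' n (y' n)).2 rfl)

theorem isProjectiveSet_realizesAt {X : Type} [TopologicalSpace X] {f g h : X → Baire}
    (hf : Continuous f) (hg : Continuous g) (hh : Continuous h) :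
    IsProjectiveSet {x | RealizesAt (f x) (g x) (h x)} := by
  refine IsProjectiveSet.all_nat (P := fun n x => ∀ v, CodeMem (f x) (.cons n (.cons v (g x))) ↔
    h x n = v) (IsProjectiveSet.all_nat (P := fun v (t : ℕ × X) =>
      CodeMem (f t.2) (.cons t.1 (.cons v (g t.2))) ↔ h t.2 t.1 = v) ?_)
  refine (isProjectiveSet_codeMem (by fun_prop) ?_).iff (.of_isOpen ?_)
  · exact Baire.continuous_cons.comp ((continuous_fst.comp continuous_snd).prodMk
      (Baire.continuous_cons.comp (continuous_fst.prodMk (by fun_prop))))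
  · have : {t : ℕ × ℕ × X | h t.2.2 t.2.1 = t.1} =
        ⋃ n, ⋃ v, {t | t.2.1 = n} ∩ ({t | t.1 = v} ∩ {t | h t.2.2 n = v}) := by
      ext t; simp [eq_comm]
    rw [this]
    refine isOpen_iUnion fun n => isOpen_iUnion fun v => ((isOpen_discrete {n}).preimage
      (f := fun t : ℕ × ℕ × X => t.2.1) (by fun_prop)).inter (((isOpen_discrete {v}).preimage
      (f := fun t : ℕ × ℕ × X => t.1) (by fun_prop)).inter ((isOpen_discrete {v}).preimage
      (f := fun t : ℕ × ℕ × X => h t.2.2 n) (by fun_prop)))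

theorem continuous_of_realizesAt {A : Type*} [TopologicalSpace A] {p x y : A → Baire}
    (hp : Continuous p) (hx : Continuous x) (h : ∀ a, RealizesAt (p a) (x a) (y a)) :
    Continuous y := by
  refine continuous_pi fun n => continuous_discrete_rng.2 fun v => ?_
  have : (fun a => y a n) ⁻¹' {v} = {a | CodeMem (p a) (.cons n (.cons v (x a)))} := by
    ext a; exact (h a n v).symm
  rw [this]
  exact continuous_Prop.1 (continuous_codeMem hp (Baire.continuous_cons.comp
    (continuous_const.prodMk (Baire.continuous_cons.comp (continuous_const.prodMk hx)))))

/-- Values in the Baire space reduce to open sets: the triples `(n, v, x)` for which `G (z, x)` has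
`n`-th entry `v` form an open set, whose code is the realizer. -/
theorem exists_realizer_curry {Z D : Set Baire} {G : Z × D → Baire} (hG : Continuous G) :
    ∃ h : Z → Baire, Continuous h ∧ ∀ z (x : D), RealizesAt (h z) x (G (z, x)) := by
  let s : Baire → Baire := fun x i => x (i + 2)
  have hs : Continuous s := by fun_prop
  let D' : Set Baire := s ⁻¹' D
  let G' : Z × D' → Baire := fun t => G (t.1, ⟨s t.2, t.2.2⟩)
  have hG' : Continuous G' := hG.comp (continuous_fst.prodMk
    ((hs.comp (continuous_subtype_val.comp continuous_snd)).subtype_mk _))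
  have hO : IsOpen {t : Z × D' | G' t ((t.2 : Baire) 0) = (t.2 : Baire) 1} := by
    have : {t : Z × D' | G' t ((t.2 : Baire) 0) = (t.2 : Baire) 1} = ⋃ n, ⋃ v,
        {t | (t.2 : Baire) 0 = n} ∩ ({t | (t.2 : Baire) 1 = v} ∩ {t | G' t n = v}) := by
      ext t; simp [eq_comm]
    rw [this]
    refine isOpen_iUnion fun n => isOpen_iUnion fun v => ((isOpen_discrete {n}).preimage
      (f := fun t : Z × D' => (t.2 : Baire) 0)
      ((continuous_apply 0).comp (continuous_subtype_val.comp continuous_snd))).inter (((isOpen_discrete {v}).preimage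
      (f := fun t : Z × D' => (t.2 : Baire) 1)
      ((continuous_apply 1).comp (continuous_subtype_val.comp continuous_snd))).inter ((isOpen_discrete {v}).preimage
      (f := fun t : Z × D' => G' t n) (by fun_prop)))
  obtain ⟨h, hh, hm⟩ := exists_code_curry hO
  exact ⟨h, hh, fun z x n v => hm z ⟨.cons n (.cons v x), x.2⟩⟩

theorem IsAdmissibleRepresentation.lift {X : Type} [TopologicalSpace X] {D : Set Baire} {δ : D → X}
    (hδ : IsAdmissibleRepresentation δ) {A : Type*} [TopologicalSpace A] {e : A → Baire}
    (he : Topology.IsEmbedding e) {f : A → X} (hf : Continuous f) :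
    ∃ g : A → D, Continuous g ∧ ∀ a, δ (g a) = f a := by
  obtain ⟨g, hg, h⟩ := hδ.factors (Set.range e) (f ∘ he.toHomeomorph.symm) (by fun_prop)
  exact ⟨g ∘ he.toHomeomorph, by fun_prop, fun a => by
    simpa using (congrFun h (he.toHomeomorph a)).symm⟩

theorem IsAdmissibleRepresentation.lift_prod {X : Type} [TopologicalSpace X] {D : Set Baire}
    {δ : D → X} (hδ : IsAdmissibleRepresentation δ) {Z W : Set Baire} {f : Z × W → X}
    (hf : Continuous f) : ∃ g : Z × W → D, Continuous g ∧ ∀ a, δ (g a) = f a := by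
  refine hδ.lift (e := fun t => Baire.interleave t.1 t.2) ?_ hf
  refine Topology.IsEmbedding.of_comp (g := fun p : Baire => (p.evens, p.odds))
    (Baire.continuous_interleave.comp (by fun_prop :
      Continuous fun t : Z × W => ((t.1 : Baire), (t.2 : Baire)))) (by fun_prop) ?_
  have : ((fun p : Baire => (p.evens, p.odds)) ∘ fun t : Z × W => Baire.interleave t.1 t.2) =
      Prod.map Subtype.val Subtype.val := by
    funext t; simp [Prod.map]
  rw [this]
  exact Topology.IsEmbedding.subtypeVal.prodMap Topology.IsEmbedding.subtypeVal

/-- An admissible representation with projective equivalence of a qcb₀-space. -/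
structure ProjRep (X : Type) [TopologicalSpace X] where
  dom : Set Baire
  rep : dom → X
  adm : IsAdmissibleRepresentation rep
  proj : IsProjectiveSet (EQ rep)
  qcb : IsQCB0Space X

theorem IsProjectiveSpace.nonempty_projRep {X : Type} [TopologicalSpace X]
    (h : IsProjectiveSpace X) : Nonempty (ProjRep X) :=
  let ⟨h, D, δ, hδ, hp⟩ := h
  ⟨⟨D, δ, hδ, hp, h⟩⟩

namespace ProjRep

variable {X Y : Type} [TopologicalSpace X] [TopologicalSpace Y]

theorem isProjectiveSpace (r : ProjRep X) : IsProjectiveSpace X := ⟨r.qcb, r.dom, r.rep, r.adm, r.proj⟩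

theorem isQuotientMap (r : ProjRep X) : Topology.IsQuotientMap r.rep := r.adm.isQuotientMap r.qcb

theorem continuous (r : ProjRep X) : Continuous r.rep := r.adm.continuous

/-- `p` names `x`. -/
def Names (r : ProjRep X) (p : Baire) (x : X) : Prop := ∃ h : p ∈ r.dom, r.rep ⟨p, h⟩ = x

theorem Names.unique {r : ProjRep X} {p : Baire} {x y : X} (h : r.Names p x) (h' : r.Names p y) :
    x = y := h.2.symm.trans h'.2

theorem names_rep (r : ProjRep X) (p : r.dom) : r.Names p (r.rep p) := ⟨p.2, rfl⟩

theorem exists_names (r : ProjRep X) (x : X) : ∃ p, r.Names p x :=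
  let ⟨p, hp⟩ := r.adm.surjective x
  ⟨p, p.2, hp⟩

theorem isProjectiveSet_dom (r : ProjRep X) : IsProjectiveSet r.dom := by
  convert r.proj.comp (P := (· ∈ EQ r.rep)) (f := fun x : Baire => (x, x)) (by fun_prop) using 1
  ext x
  exact ⟨fun hx => ⟨hx, hx, rfl⟩, fun ⟨hx, _⟩ => hx⟩

theorem isProjectiveSet_eq (r : ProjRep X) :
    IsProjectiveSet {t : Baire × Baire | ∃ x, r.Names t.1 x ∧ r.Names t.2 x} := by
  convert r.proj using 1
  ext t
  exact ⟨fun ⟨_, ⟨h, e⟩, ⟨h', e'⟩⟩ => ⟨h, h', e.trans e'.symm⟩,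
    fun ⟨h, h', e⟩ => ⟨_, ⟨h, e⟩, ⟨h', rfl⟩⟩⟩

/-- A continuous realizer of `f` has a graph that is the trace of a closed set on the projective set
of names; the names of `f x` are those equivalent to the realized one. -/
theorem isProjectiveSet_graph (rX : ProjRep X) (rY : ProjRep Y) {f : X → Y} (hf : Continuous f) :
    IsProjectiveSet {t : Baire × Baire | ∃ x, rX.Names t.1 x ∧ rY.Names t.2 (f x)} := by
  obtain ⟨F, hF, hfF⟩ := rY.adm.factors rX.dom (f ∘ rX.rep) (hf.comp rX.continuous)
  have hcl : IsClosed {t : rX.dom × Baire | (F t.1 : Baire) = t.2} :=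
    isClosed_eq (by fun_prop) (by fun_prop)
  obtain ⟨C, hC, hCF⟩ := ((Topology.IsInducing.subtypeVal (t := rX.dom)).prodMap
    (Topology.IsInducing.id (X := Baire))).isClosed_iff.1 hcl
  have hCp : IsProjectiveSet C := by
    simpa using (IsProjectiveSet.of_isOpen (A := {t | t ∉ C}) hC.isOpen_compl).not
  have key : ∀ (p : rX.dom) q, ((p : Baire), q) ∈ C ↔ (F p : Baire) = q := fun p q =>
    Set.ext_iff.1 hCF (p, q)
  have h := (((rX.isProjectiveSet_dom.comp (P := (· ∈ rX.dom)) (f := fun t : Baire × Baire × Baire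
    => t.2.1) (by fun_prop)).and (hCp.comp (P := (· ∈ C)) (f := fun t : Baire × Baire × Baire
    => (t.2.1, t.1)) (by fun_prop))).and (rY.isProjectiveSet_eq.comp
    (P := fun t => ∃ x, rY.Names t.1 x ∧ rY.Names t.2 x)
    (f := fun t : Baire × Baire × Baire => (t.1, t.2.2)) (by fun_prop)))
  convert IsProjectiveSet.ex (P := fun c (t : Baire × Baire) => (t.1 ∈ rX.dom ∧ (t.1, c) ∈ C) ∧
    ∃ x, rY.Names c x ∧ rY.Names t.2 x) h using 1
  ext t
  constructor
  · rintro ⟨_, ⟨h, rfl⟩, h'⟩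
    exact ⟨F ⟨_, h⟩, ⟨h, (key ⟨_, h⟩ _).2 rfl⟩, _, ⟨(F _).2, (congrFun hfF _).symm⟩, h'⟩
  · rintro ⟨c, ⟨h, hc⟩, y, hy, hy'⟩
    obtain rfl := (key ⟨_, h⟩ _).1 hc
    refine ⟨_, ⟨h, rfl⟩, ?_⟩
    have e : f (rX.rep ⟨_, h⟩) = y :=
      Names.unique (r := rY) ⟨(F ⟨_, h⟩).2, (congrFun hfF _).symm⟩ hy
    exact e ▸ hy'

/-! ### Exponentials -/

/-- The set of continuous functions between represented spaces, with the final topology of the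
representation by realizers. -/
@[ext] structure Exp (rX : ProjRep X) (rY : ProjRep Y) where
  toFun : X → Y
  cont : Continuous toFun

variable (rX : ProjRep X) (rY : ProjRep Y)

def Realizes (p : Baire) (f : X → Y) : Prop :=
  ∀ x : rX.dom, ∃ y, RealizesAt p x y ∧ rY.Names y (f (rX.rep x))

variable {rX rY} in
theorem Realizes.unique {p : Baire} {f g : X → Y} (hf : Realizes rX rY p f)
    (hg : Realizes rX rY p g) : f = g := by
  funext x
  obtain ⟨x, rfl⟩ := rX.adm.surjective x
  obtain ⟨y, hy, h⟩ := hf x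
  obtain ⟨y', hy', h'⟩ := hg x
  rw [hy.unique hy'] at h
  exact h.unique h'

def expDom : Set Baire := {p | ∃ f : Exp rX rY, Realizes rX rY p f.toFun}

noncomputable def expRep : expDom rX rY → Exp rX rY :=
  fun p => p.2.choose

theorem expRep_realizes (p : expDom rX rY) : Realizes rX rY p (expRep rX rY p).toFun := p.2.choose_spec

theorem expRep_eq_iff (p : expDom rX rY) (f : Exp rX rY) : expRep rX rY p = f ↔ Realizes rX rY p f.toFun := by
  refine ⟨fun h => h ▸ expRep_realizes rX rY p, fun h => Exp.ext ?_⟩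
  exact (expRep_realizes rX rY p).unique h

noncomputable instance : TopologicalSpace (Exp rX rY) := .coinduced (expRep rX rY) inferInstance

/-- This yields both the continuity of curried maps and, for a constant family, the existence of a
realizer of every continuous function. -/
theorem exists_curry {Z : Set Baire} {f : Z × rX.dom → Y} (hf : Continuous f) {F : Z → Exp rX rY}
    (hF : ∀ z x, (F z).toFun (rX.rep x) = f (z, x)) : Continuous F ∧ ∃ h : Z → Baire,
      Continuous h ∧ ∀ z, Realizes rX rY (h z) (F z).toFun := by
  obtain ⟨G, hG, hGf⟩ := rY.adm.lift_prod hf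
  obtain ⟨h, hh, hr⟩ := exists_realizer_curry (G := fun t => (G t : Baire)) (by fun_prop)
  have hR : ∀ z, Realizes rX rY (h z) (F z).toFun := fun z x =>
    ⟨_, hr z x, (G (z, x)).2, by rw [hF, ← hGf]⟩
  refine ⟨?_, h, hh, hR⟩
  have : F = expRep rX rY ∘ fun z => ⟨h z, F z, hR z⟩ :=
    funext fun z => ((expRep_eq_iff rX rY _ _).2 (hR z)).symm
  rw [this]
  exact continuous_coinduced_rng.comp (hh.subtype_mk _)

theorem expRep_isQuotientMap : Topology.IsQuotientMap (expRep rX rY) := by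
  refine (Topology.isQuotientMap_iff _).2 ⟨⟨rfl⟩, fun f => ?_⟩
  obtain ⟨-, h, -, hh⟩ := exists_curry rX rY (Z := Set.univ) (F := fun _ => f)
    (f := fun t => f.toFun (rX.rep t.2)) (f.cont.comp (rX.continuous.comp continuous_snd))
    fun _ _ => rfl
  have := hh ⟨0, trivial⟩
  exact ⟨⟨_, f, this⟩, (expRep_eq_iff rX rY _ _).2 this⟩

theorem continuous_expRep_apply :
    Continuous fun t : expDom rX rY × rX.dom => (expRep rX rY t.1).toFun (rX.rep t.2) := by
  choose y hy hn using expRep_realizes rX rY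
  have hc : Continuous fun t : expDom rX rY × rX.dom => y t.1 t.2 :=
    continuous_of_realizesAt (p := fun t => t.1) (x := fun t => t.2) (by fun_prop) (by fun_prop)
      fun t => hy t.1 t.2
  have : (fun t : expDom rX rY × rX.dom => (expRep rX rY t.1).toFun (rX.rep t.2)) =
      fun t => rY.rep ⟨y t.1 t.2, (hn t.1 t.2).1⟩ := funext fun t => (hn t.1 t.2).2.symm
  rw [this]
  exact rY.continuous.comp (hc.subtype_mk fun t => (hn t.1 t.2).1)

instance : T0Space (Exp rX rY) := by
  have := rY.qcb.1
  refine ⟨fun f g h => Exp.ext (funext fun x => ?_)⟩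
  obtain ⟨x, rfl⟩ := rX.adm.surjective x
  refine (h.map (f := fun f : Exp rX rY => f.toFun (rX.rep x)) ?_).eq
  refine (expRep_isQuotientMap rX rY).continuous_iff.2 ?_
  exact (continuous_expRep_apply rX rY).comp (Continuous.prodMk_left x)

/-- The relation `Q` mentions no function: `p` and `q` are to send equivalent names to equivalent
names. Then both respect equality of points, and the common function they induce is continuous
because `rX.rep` is a quotient map. -/
theorem exp_isProjectiveSpace : IsProjectiveSpace (Exp rX rY) := by
  refine .of_isQuotientMap (expRep_isQuotientMap rX rY) ?_
  let Q : Baire → Baire → Prop := fun p q => ∀ x x', (∃ a, rX.Names x a ∧ rX.Names x' a) →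
    ∃ y y', (RealizesAt p x y ∧ RealizesAt q x' y') ∧ ∃ b, rY.Names y b ∧ rY.Names y' b
  have hEQ : EQ (expRep rX rY) = {t | Q t.1 t.2} := by
    ext ⟨p, q⟩
    constructor
    · rintro ⟨hp, hq, e⟩ x x' ⟨a, ⟨hx, ha⟩, ⟨hx', ha'⟩⟩
      obtain ⟨y, hy, hn⟩ := expRep_realizes rX rY ⟨p, hp⟩ ⟨x, hx⟩
      obtain ⟨y', hy', hn'⟩ := expRep_realizes rX rY ⟨q, hq⟩ ⟨x', hx'⟩
      exact ⟨y, y', ⟨hy, hy'⟩, _, hn, by rwa [e, ha, ← ha']⟩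
    · intro h
      have hQ : ∀ x : rX.dom, ∃ y, RealizesAt p x y ∧ ∃ b, rY.Names y b ∧
          ∀ x' : rX.dom, rX.rep x' = rX.rep x → ∃ y', RealizesAt q x' y' ∧ rY.Names y' b := by
        intro x
        obtain ⟨y, -, ⟨hy, -⟩, b, hb, -⟩ := h x x ⟨_, rX.names_rep x, rX.names_rep x⟩
        refine ⟨y, hy, b, hb, fun x' e => ?_⟩
        obtain ⟨y₁, y', ⟨hy₁, hy'⟩, b', hb₁, hb'⟩ :=
          h x x' ⟨_, rX.names_rep x, e ▸ rX.names_rep x'⟩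
        rw [hy₁.unique hy] at hb₁
        exact ⟨y', hy', hb.unique hb₁ ▸ hb'⟩
      choose y hy b hb hb' using hQ
      -- Both points are named by the value of `q` at `x'`.
      have hinv : ∀ x x', rX.rep x' = rX.rep x → b x = b x' := by
        intro x x' e
        obtain ⟨y₁, h₁, h₂⟩ := hb' x x' e
        obtain ⟨y₂, h₃, h₄⟩ := hb' x' x' rfl
        rw [h₁.unique h₃] at h₂
        exact h₂.unique h₄
      have hbc : Continuous b := by
        have : b = fun x => rY.rep ⟨y x, (hb x).1⟩ := funext fun x => (hb x).2.symm
        rw [this]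
        exact rY.continuous.comp ((continuous_of_realizesAt (p := fun _ => p)
          (x := fun x : rX.dom => (x : Baire)) (by fun_prop) (by fun_prop) hy).subtype_mk _)
      let g : X → Y := fun a => b (rX.adm.surjective a).choose
      have hg : ∀ x, g (rX.rep x) = b x := fun x =>
        (hinv _ _ (rX.adm.surjective (rX.rep x)).choose_spec.symm)
      let f : Exp rX rY := ⟨g, rX.isQuotientMap.continuous_iff.2
        (by rwa [show g ∘ rX.rep = b from funext hg])⟩
      have hp : Realizes rX rY p f.toFun := fun x => ⟨y x, hy x, by
        show rY.Names _ (g _)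
        exact (hg x).symm ▸ hb x⟩
      have hq : Realizes rX rY q f.toFun := fun x => by
        show ∃ y, _ ∧ rY.Names _ (g _)
        exact (hg x).symm ▸ hb' x x rfl
      exact ⟨⟨f, hp⟩, ⟨f, hq⟩, ((expRep_eq_iff rX rY _ f).2 hp).trans
        ((expRep_eq_iff rX rY _ f).2 hq).symm⟩
  rw [hEQ]
  refine IsProjectiveSet.all (P := fun x (t : Baire × Baire) => ∀ x', (∃ a, rX.Names x a ∧
    rX.Names x' a) → ∃ y y', (RealizesAt t.1 x y ∧ RealizesAt t.2 x' y') ∧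
    ∃ b, rY.Names y b ∧ rY.Names y' b)
    (IsProjectiveSet.all (P := fun x' (t : Baire × Baire × Baire) => (∃ a, rX.Names t.1 a ∧
    rX.Names x' a) → ∃ y y', (RealizesAt t.2.1 t.1 y ∧ RealizesAt t.2.2 x' y') ∧
    ∃ b, rY.Names y b ∧ rY.Names y' b) (IsProjectiveSet.imp (rX.isProjectiveSet_eq.comp
      (P := fun t => ∃ x, rX.Names t.1 x ∧ rX.Names t.2 x)
      (f := fun t : Baire × Baire × Baire × Baire => (t.2.1, t.1)) (by fun_prop)) ?_))
  refine IsProjectiveSet.ex (P := fun y (t : Baire × Baire × Baire × Baire) => ∃ y',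
    (RealizesAt t.2.2.1 t.2.1 y ∧ RealizesAt t.2.2.2 t.1 y') ∧
    ∃ b, rY.Names y b ∧ rY.Names y' b) (IsProjectiveSet.ex
    (P := fun y' (t : Baire × Baire × Baire × Baire × Baire) =>
    (RealizesAt t.2.2.2.1 t.2.2.1 t.1 ∧ RealizesAt t.2.2.2.2 t.2.1 y') ∧
    ∃ b, rY.Names t.1 b ∧ rY.Names y' b) ?_)
  exact ((isProjectiveSet_realizesAt (by fun_prop) (by fun_prop) (by fun_prop)).and
    (isProjectiveSet_realizesAt (by fun_prop) (by fun_prop) (by fun_prop))).and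
    (rY.isProjectiveSet_eq.comp (P := fun t => ∃ x, rY.Names t.1 x ∧ rY.Names t.2 x)
      (f := fun t : Baire × Baire × Baire × Baire × Baire × Baire => (t.2.1, t.1)) (by fun_prop))

/-! ### Pullbacks -/

variable {B : Type}

/-- The set-theoretic pullback of two maps between represented spaces, with the final topology of
the representation by pairs of names. -/
@[ext] structure Pullback (f : X → B) (g : Y → B) (rX : ProjRep X) (rY : ProjRep Y) where
  fst : X
  snd : Y
  eq : f fst = g snd

variable {rX rY} {f : X → B} {g : Y → B}

/-- The interleaved pairs of names of the points of the pullback. -/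
def pullbackDom (f : X → B) (g : Y → B) (rX : ProjRep X) (rY : ProjRep Y) : Set Baire :=
  {p | ∃ (h : p.evens ∈ rX.dom) (h' : p.odds ∈ rY.dom), f (rX.rep ⟨_, h⟩) = g (rY.rep ⟨_, h'⟩)}

def pullbackRep (p : pullbackDom f g rX rY) : Pullback f g rX rY :=
  ⟨rX.rep ⟨_, p.2.1⟩, rY.rep ⟨_, p.2.2.1⟩, p.2.2.2⟩

instance : TopologicalSpace (Pullback f g rX rY) := .coinduced pullbackRep inferInstance

theorem pullbackRep_isQuotientMap :
    Topology.IsQuotientMap (pullbackRep (f := f) (g := g) (rX := rX) (rY := rY)) := by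
  refine (Topology.isQuotientMap_iff _).2 ⟨⟨rfl⟩, fun ⟨x, y, e⟩ => ?_⟩
  obtain ⟨⟨p, hp⟩, rfl⟩ := rX.adm.surjective x
  obtain ⟨⟨q, hq⟩, rfl⟩ := rY.adm.surjective y
  refine ⟨⟨p.interleave q, by simpa [pullbackDom] using ⟨hp, hq, e⟩⟩, ?_⟩
  simp [pullbackRep]

theorem Pullback.continuous_fst : Continuous (Pullback.fst (f := f) (g := g) (rX := rX) (rY := rY)) :=
  pullbackRep_isQuotientMap.continuous_iff.2 (rX.continuous.comp
    ((Baire.continuous_evens.comp continuous_subtype_val).subtype_mk _))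

theorem Pullback.continuous_snd : Continuous (Pullback.snd (f := f) (g := g) (rX := rX) (rY := rY)) :=
  pullbackRep_isQuotientMap.continuous_iff.2 (rY.continuous.comp
    ((Baire.continuous_odds.comp continuous_subtype_val).subtype_mk _))

instance : T0Space (Pullback f g rX rY) := by
  have := rX.qcb.1
  have := rY.qcb.1
  exact ⟨fun a b h => Pullback.ext (h.map Pullback.continuous_fst).eq
    (h.map Pullback.continuous_snd).eq⟩

/-- The pullback carries a final topology, not that of a subspace of the product, so continuity into
it is checked on names: both components are lifted along a quotient map from a subspace of the Baire
space onto `Z`. -/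
theorem Pullback.continuous_mk {Z : Type} [TopologicalSpace Z] (hZ : IsQCB0Space Z)
    {F : Z → Pullback f g rX rY} (h₁ : Continuous fun z => (F z).fst)
    (h₂ : Continuous fun z => (F z).snd) : Continuous F := by
  obtain ⟨D, π, hπ⟩ := hZ.exists_isQuotientMap
  obtain ⟨a, ha, ha'⟩ := rX.adm.factors D _ (h₁.comp hπ.continuous)
  obtain ⟨b, hb, hb'⟩ := rY.adm.factors D _ (h₂.comp hπ.continuous)
  rw [hπ.continuous_iff]
  have hm : ∀ d, Baire.interleave (a d) (b d) ∈ pullbackDom f g rX rY := fun d => by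
    have h1 := congrFun ha' d
    have h2 := congrFun hb' d
    simp only [Function.comp_apply] at h1 h2
    simp [pullbackDom, ← h1, ← h2, (F (π d)).eq]
  have : F ∘ π = pullbackRep ∘ fun d => ⟨_, hm d⟩ := by
    funext d
    have h1 := congrFun ha' d
    have h2 := congrFun hb' d
    simp only [Function.comp_apply] at h1 h2
    refine Pullback.ext ?_ ?_ <;> simp [pullbackRep, h1, h2]
  rw [this]
  exact continuous_coinduced_rng.comp ((Baire.continuous_interleave.comp
    (by fun_prop : Continuous fun d => ((a d : Baire), (b d : Baire)))).subtype_mk _)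

theorem pullback_isProjectiveSpace [TopologicalSpace B] (rB : ProjRep B) (hf : Continuous f) (hg : Continuous g) :
    IsProjectiveSpace (Pullback f g rX rY) := by
  refine .of_isQuotientMap (pullbackRep_isQuotientMap (f := f) (g := g)) ?_
  have h := ((rX.isProjectiveSet_eq.comp (P := fun t => ∃ x, rX.Names t.1 x ∧ rX.Names t.2 x)
      (f := fun t : Baire × Baire => (t.1.evens, t.2.evens)) (by fun_prop)).and
    (rY.isProjectiveSet_eq.comp (P := fun t => ∃ x, rY.Names t.1 x ∧ rY.Names t.2 x)
      (f := fun t : Baire × Baire => (t.1.odds, t.2.odds)) (by fun_prop))).and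
    (IsProjectiveSet.ex (P := fun c (t : Baire × Baire) =>
      (∃ x, rX.Names t.1.evens x ∧ rB.Names c (f x)) ∧ ∃ y, rY.Names t.1.odds y ∧ rB.Names c (g y))
      (((isProjectiveSet_graph rX rB hf).comp
        (P := fun t => ∃ x, rX.Names t.1 x ∧ rB.Names t.2 (f x))
        (f := fun t : Baire × Baire × Baire => (t.2.1.evens, t.1)) (by fun_prop)).and
      ((isProjectiveSet_graph rY rB hg).comp
        (P := fun t => ∃ x, rY.Names t.1 x ∧ rB.Names t.2 (g x))
        (f := fun t : Baire × Baire × Baire => (t.2.1.odds, t.1)) (by fun_prop))))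
  convert h using 1
  ext ⟨p, q⟩
  constructor
  · rintro ⟨⟨h₁, h₂, e⟩, ⟨h₃, h₄, e'⟩, E⟩
    obtain ⟨c, hc⟩ := rB.exists_names (f (rX.rep ⟨_, h₁⟩))
    exact ⟨⟨⟨_, ⟨h₁, rfl⟩, ⟨h₃, (congrArg Pullback.fst E).symm⟩⟩,
      ⟨_, ⟨h₂, rfl⟩, ⟨h₄, (congrArg Pullback.snd E).symm⟩⟩⟩, c, ⟨_, ⟨h₁, rfl⟩, hc⟩,
      ⟨_, ⟨h₂, rfl⟩, e ▸ hc⟩⟩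
  · rintro ⟨⟨⟨x, ⟨h₁, rfl⟩, ⟨h₃, e₃⟩⟩, ⟨y, ⟨h₂, rfl⟩, ⟨h₄, e₄⟩⟩⟩, c, ⟨x', hx', hc⟩, ⟨y', hy', hc'⟩⟩
    obtain rfl := hx'.unique ⟨h₁, rfl⟩
    obtain rfl := hy'.unique ⟨h₂, rfl⟩
    have e := hc.unique hc'
    exact ⟨⟨h₁, h₂, e⟩, ⟨h₃, h₄, by rw [e₃, e₄, e]⟩, Pullback.ext e₃.symm e₄.symm⟩

end ProjRep

/-! ### Disjoint sums of names and pushouts -/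

theorem IsProjectiveSpace.of_embedded_presentation {X A : Type} [TopologicalSpace X] [T0Space X]
    [TopologicalSpace A] {e : A → Baire} (he : Topology.IsEmbedding e) {π : A → X}
    (hπ : Continuous π) (hs : Function.Surjective π)
    {R : Baire → Baire → Prop} (hR : ∀ x y : A, R (e x) (e y) → π x = π y)
    (hdesc : ∀ χ : A → Prop, Continuous χ → (∀ x y : A, R (e x) (e y) → (χ x ↔ χ y)) →
      ∃ χ' : X → Prop, Continuous χ' ∧ ∀ x, χ x ↔ χ' (π x))
    (hDp : IsProjectiveSet (Set.range e)) (hRp : IsProjectiveSet {t : Baire × Baire | R t.1 t.2}) :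
    IsProjectiveSpace X := by
  let E := he.toHomeomorph
  have hE : ∀ a, e (E.symm a) = a := fun a => congrArg Subtype.val (E.apply_symm_apply a)
  refine .of_presentation (π := π ∘ E.symm) (hπ.comp E.symm.continuous)
    (hs.comp E.symm.surjective) (R := R) (fun x y h => hR _ _ (by rwa [hE, hE]))
    (fun χ hχ hinv => ?_) hDp hRp
  obtain ⟨χ', h, h'⟩ := hdesc (χ ∘ E) (hχ.comp E.continuous) fun x y h => hinv _ _ h
  exact ⟨χ', h, fun x => by simpa using h' (E.symm x)⟩

def Baire.tail (p : Baire) : Baire := fun i => p (i + 1)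

@[fun_prop] theorem Baire.continuous_tail : Continuous Baire.tail := by
  unfold Baire.tail; fun_prop

@[simp] theorem Baire.tail_cons (n : ℕ) (p : Baire) : (Baire.cons n p).tail = p := rfl

@[simp] theorem Baire.cons_zero (n : ℕ) (p : Baire) : Baire.cons n p 0 = n := rfl

theorem Baire.cons_tail (p : Baire) : Baire.cons (p 0) p.tail = p := by
  ext i; cases i <;> rfl

theorem isProjectiveSet_head (n : ℕ) : IsProjectiveSet {p : Baire | p 0 = n} :=
  .of_isOpen ((isOpen_discrete {n}).preimage (f := fun p : Baire => p 0) (continuous_apply 0))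

/-- The names of a disjoint sum. -/
def sumName {D E : Set Baire} : D ⊕ E → Baire :=
  Sum.elim (fun p => .cons 0 p) (fun p => .cons 1 p)

theorem sumName_isEmbedding {D E : Set Baire} : Topology.IsEmbedding (sumName (D := D) (E := E)) := by
  have hc : Continuous (sumName (D := D) (E := E)) :=
    (Baire.continuous_cons.comp (continuous_const.prodMk continuous_subtype_val)).sumElim
      (Baire.continuous_cons.comp (continuous_const.prodMk continuous_subtype_val))
  have h0 : ∀ (n : ℕ) (O : Set Baire), IsOpen O → IsOpen {p : Baire | p 0 = n ∧ p.tail ∈ O} :=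
    fun n O hO => ((isOpen_discrete {n}).preimage (f := fun p : Baire => p 0)
      (continuous_apply 0)).inter (hO.preimage Baire.continuous_tail)
  refine ⟨⟨le_antisymm hc.le_induced fun U hU => isOpen_induced_iff.2 ?_⟩, ?_⟩
  · obtain ⟨h₁, h₂⟩ := isOpen_sum_iff.1 hU
    obtain ⟨O₁, hO₁, e₁⟩ := isOpen_induced_iff.1 h₁
    obtain ⟨O₂, hO₂, e₂⟩ := isOpen_induced_iff.1 h₂
    refine ⟨_, (h0 0 O₁ hO₁).union (h0 1 O₂ hO₂), ?_⟩
    ext (p | p)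
    · simpa [sumName] using Set.ext_iff.1 e₁ p
    · simpa [sumName] using Set.ext_iff.1 e₂ p
  · rintro (p | p) (q | q) h
    · exact congrArg Sum.inl (Subtype.ext (congrArg Baire.tail h))
    · exact absurd (congrFun h 0) (by simp [sumName])
    · exact absurd (congrFun h 0) (by simp [sumName])
    · exact congrArg Sum.inr (Subtype.ext (congrArg Baire.tail h))

section Pushout

variable {X Y Z : Type} [TopologicalSpace X] [TopologicalSpace Y]

/-- The `T₀`-reflection of the topological pushout. -/
def QCBPushout (f : Z → X) (g : Z → Y) : Type :=
  SeparationQuotient (Quot fun a b : X ⊕ Y => ∃ z, a = .inl (f z) ∧ b = .inr (g z))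

namespace QCBPushout

variable {f : Z → X} {g : Z → Y}

instance : TopologicalSpace (QCBPushout f g) := inferInstanceAs (TopologicalSpace (SeparationQuotient _))

instance : T0Space (QCBPushout f g) := inferInstanceAs (T0Space (SeparationQuotient _))

variable (f g) in
def mk (a : X ⊕ Y) : QCBPushout f g := SeparationQuotient.mk (Quot.mk _ a)

theorem mk_isQuotientMap : Topology.IsQuotientMap (mk f g) :=
  SeparationQuotient.isQuotientMap_mk.comp isQuotientMap_quot_mk

theorem mk_inl_eq_mk_inr (z : Z) : mk f g (.inl (f z)) = mk f g (.inr (g z)) :=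
  congrArg SeparationQuotient.mk (Quot.sound ⟨z, rfl, rfl⟩)

theorem exists_desc {T : Type*} [TopologicalSpace T] [T0Space T] {h : X → T} {k : Y → T}
    (hh : Continuous h) (hk : Continuous k) (e : ∀ z, h (f z) = k (g z)) :
    ∃ u : QCBPushout f g → T, Continuous u ∧ (∀ x, u (mk f g (.inl x)) = h x) ∧
      ∀ y, u (mk f g (.inr y)) = k y := by
  have h1 : Continuous (Quot.lift (r := fun a b : X ⊕ Y => ∃ z, a = .inl (f z) ∧ b = .inr (g z))
    (Sum.elim h k) (by rintro _ _ ⟨z, rfl, rfl⟩; exact e z)) := continuous_quot_lift _ (hh.sumElim hk)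
  exact ⟨SeparationQuotient.lift _ fun a b hab => (hab.map h1).eq,
    SeparationQuotient.continuous_lift h1, fun _ => rfl, fun _ => rfl⟩

/-- The `T₀`-reflection may identify more than the gluing does, and its kernel is not described
here. It is enough that `R` is definable and that its invariant open sets are those of the pushout;
`R` need be neither transitive nor symmetric. -/
theorem isProjectiveSpace [TopologicalSpace Z] (rX : ProjRep X) (rY : ProjRep Y) (rZ : ProjRep Z)
    (hf : Continuous f) (hg : Continuous g) : IsProjectiveSpace (QCBPushout f g) := by
  let R : Baire → Baire → Prop := fun p q =>
    ((p 0 = 0 ∧ q 0 = 0) ∧ ∃ x, rX.Names p.tail x ∧ rX.Names q.tail x) ∨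
    ((p 0 = 1 ∧ q 0 = 1) ∧ ∃ y, rY.Names p.tail y ∧ rY.Names q.tail y) ∨
    ((p 0 = 0 ∧ q 0 = 1) ∧ ∃ c, (∃ z, rZ.Names c z ∧ rX.Names p.tail (f z)) ∧
      ∃ z, rZ.Names c z ∧ rY.Names q.tail (g z))
  have hxq := rX.isQuotientMap
  have hyq := rY.isQuotientMap
  refine .of_embedded_presentation (sumName_isEmbedding (D := rX.dom) (E := rY.dom))
    (π := fun a => mk f g (Sum.map rX.rep rY.rep a))
    (mk_isQuotientMap.continuous.comp (rX.continuous.sumMap rY.continuous))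
    (mk_isQuotientMap.surjective.comp (Sum.map_surjective.2 ⟨hxq.surjective, hyq.surjective⟩))
    (R := R) ?_ ?_ ?_ ?_
  · rintro (x | x) (y | y) (⟨⟨h₁, h₂⟩, a, ha, hb⟩ | ⟨⟨h₁, h₂⟩, a, ha, hb⟩ |
      ⟨⟨h₁, h₂⟩, c, ⟨z, hz, ha⟩, ⟨z', hz', hb⟩⟩) <;> simp [sumName] at h₁ h₂
    · simp only [Sum.map_inl]
      rw [(rX.names_rep x).unique ha, (rX.names_rep y).unique hb]
    · obtain rfl := hz.unique hz'
      simp only [Sum.map_inl, Sum.map_inr]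
      rw [(rX.names_rep x).unique ha, (rY.names_rep y).unique hb]
      exact mk_inl_eq_mk_inr z
    · simp only [Sum.map_inr]
      rw [(rY.names_rep x).unique ha, (rY.names_rep y).unique hb]
  · intro χ hχ hinv
    have h₁ : ∀ x y, rX.rep x = rX.rep y → (χ (.inl x) ↔ χ (.inl y)) := fun x y e =>
      hinv _ _ (.inl ⟨⟨rfl, rfl⟩, _, rX.names_rep x, e ▸ rX.names_rep y⟩)
    have h₂ : ∀ x y, rY.rep x = rY.rep y → (χ (.inr x) ↔ χ (.inr y)) := fun x y e =>
      hinv _ _ (.inr (.inl ⟨⟨rfl, rfl⟩, _, rY.names_rep x, e ▸ rY.names_rep y⟩))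
    choose a ha using hxq.surjective
    choose b hb using hyq.surjective
    obtain ⟨u, hu, hux, huy⟩ := exists_desc (f := f) (g := g) (T := Prop)
      (h := fun x => χ (.inl (a x))) (k := fun y => χ (.inr (b y)))
      (hxq.continuous_iff.2 (by
        rw [show (fun x => χ (.inl (a x))) ∘ rX.rep = fun x => χ (.inl x) from
          funext fun x => propext (h₁ _ _ (ha _))]
        exact hχ.comp continuous_inl))
      (hyq.continuous_iff.2 (by
        rw [show (fun x => χ (.inr (b x))) ∘ rY.rep = fun x => χ (.inr x) from
          funext fun x => propext (h₂ _ _ (hb _))]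
        exact hχ.comp continuous_inr))
      (fun z => propext (hinv _ _ (.inr (.inr ⟨⟨rfl, rfl⟩, by
        obtain ⟨c, hc⟩ := rZ.exists_names z
        exact ⟨c, ⟨z, hc, ⟨(a (f z)).2, ha _⟩⟩, ⟨z, hc, ⟨(b (g z)).2, hb _⟩⟩⟩⟩))))
    refine ⟨u, hu, ?_⟩
    rintro (x | y)
    · rw [Sum.map_inl, hux]
      exact h₁ _ _ (ha _).symm
    · rw [Sum.map_inr, huy]
      exact h₂ _ _ (hb _).symm
  · have h := ((isProjectiveSet_head 0).and (rX.isProjectiveSet_dom.comp (P := (· ∈ rX.dom))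
      Baire.continuous_tail)).or ((isProjectiveSet_head 1).and (rY.isProjectiveSet_dom.comp
      (P := (· ∈ rY.dom)) Baire.continuous_tail))
    convert h using 1
    ext p
    constructor
    · rintro ⟨x | y, rfl⟩
      exacts [.inl ⟨rfl, x.2⟩, .inr ⟨rfl, y.2⟩]
    · rintro (⟨h, h'⟩ | ⟨h, h'⟩)
      · exact ⟨.inl ⟨_, h'⟩, (congrArg (Baire.cons · p.tail) h.symm).trans p.cons_tail⟩
      · exact ⟨.inr ⟨_, h'⟩, (congrArg (Baire.cons · p.tail) h.symm).trans p.cons_tail⟩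
  · have hh := fun n m => ((isProjectiveSet_head n).comp (P := fun p => p 0 = n)
      (f := fun t : Baire × Baire => t.1) (by fun_prop)).and ((isProjectiveSet_head m).comp
      (P := fun p => p 0 = m) (f := fun t : Baire × Baire => t.2) (by fun_prop))
    refine ((hh 0 0).and (rX.isProjectiveSet_eq.comp
      (P := fun t => ∃ x, rX.Names t.1 x ∧ rX.Names t.2 x)
      (f := fun t : Baire × Baire => (t.1.tail, t.2.tail)) (by fun_prop))).or
      (((hh 1 1).and (rY.isProjectiveSet_eq.comp
      (P := fun t => ∃ x, rY.Names t.1 x ∧ rY.Names t.2 x)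
      (f := fun t : Baire × Baire => (t.1.tail, t.2.tail)) (by fun_prop))).or
      ((hh 0 1).and (IsProjectiveSet.ex (P := fun c (t : Baire × Baire) =>
        (∃ z, rZ.Names c z ∧ rX.Names t.1.tail (f z)) ∧
        ∃ z, rZ.Names c z ∧ rY.Names t.2.tail (g z)) (IsProjectiveSet.and ?_ ?_))))
    · exact (ProjRep.isProjectiveSet_graph rZ rX hf).comp
        (P := fun t => ∃ x, rZ.Names t.1 x ∧ rX.Names t.2 (f x))
        (f := fun t : Baire × Baire × Baire => (t.1, t.2.1.tail)) (by fun_prop)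
    · exact (ProjRep.isProjectiveSet_graph rZ rY hg).comp
        (P := fun t => ∃ x, rZ.Names t.1 x ∧ rY.Names t.2 (g x))
        (f := fun t : Baire × Baire × Baire => (t.1, t.2.2.tail)) (by fun_prop)

end QCBPushout

end Pushout

/-! ### Basic projective spaces -/

theorem isProjectiveSpace_nat : IsProjectiveSpace ℕ := by
  have hq : Topology.IsQuotientMap fun p : (Set.univ : Set Baire) => (p : Baire) 0 := by
    refine Topology.IsQuotientMap.of_inverse (f := fun n => ⟨fun _ => n, trivial⟩) ?_ ?_ fun _ => rfl
    · exact continuous_of_discreteTopology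
    · exact (continuous_apply 0).comp continuous_subtype_val
  refine .of_isQuotientMap hq ?_
  convert IsProjectiveSet.of_isOpen (isOpen_discrete {t : ℕ × ℕ | t.1 = t.2} |>.preimage
    (f := fun t : Baire × Baire => (t.1 0, t.2 0)) (by fun_prop)) using 1
  ext t
  exact ⟨fun ⟨_, _, e⟩ => e, fun e => ⟨trivial, trivial, e⟩⟩

theorem isProjectiveSpace_punit : IsProjectiveSpace PUnit := by
  have hq : Topology.IsQuotientMap fun _ : (Set.univ : Set Baire) => PUnit.unit :=
    Topology.IsQuotientMap.of_inverse (f := fun _ => ⟨0, trivial⟩) continuous_const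
      continuous_const fun _ => rfl
  refine .of_isQuotientMap hq ?_
  convert IsProjectiveSet.const (X := Baire × Baire) True using 1
  ext t
  exact ⟨fun _ => trivial, fun _ => ⟨trivial, trivial, rfl⟩⟩

theorem isProjectiveSpace_pempty : IsProjectiveSpace PEmpty := by
  refine .of_presentation (D := ∅) (π := fun p => p.2.elim) (R := fun _ _ => False)
    (continuous_of_const fun p => p.2.elim) (fun x => x.elim) (fun p => p.2.elim)
    (fun χ _ _ => ⟨fun x => x.elim, continuous_of_const fun x => x.elim, fun x => x.2.elim⟩)
    (.const False) (.const False)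

theorem isProjectiveSpace_prop : IsProjectiveSpace Prop := by
  let f : Baire → Prop := fun p => ∃ i, p i ≠ 0
  have hf : IsOpen {p | f p} := by
    simp only [f, Set.ofPred_exists]
    exact isOpen_iUnion fun i => (isOpen_discrete {0}ᶜ).preimage
      (f := fun p : Baire => p i) (continuous_apply i)
  -- The only sequence at which `f` fails is zero, and it is a limit of sequences with a single
  -- entry `1`. So an open set containing zero has full image, and any other nonempty open set has
  -- image `{True}`.
  have hfo : IsOpenMap f := by
    intro U hU
    by_cases h : ∃ p ∈ U, ¬ f p
    · obtain ⟨p, hp, hfp⟩ := h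
      have ht : Filter.Tendsto (fun k => (Pi.single k 1 : Baire)) Filter.atTop (nhds p) := by
        refine tendsto_pi_nhds.2 fun i => tendsto_const_nhds.congr' ?_
        filter_upwards [Filter.eventually_gt_atTop i] with k hk
        rw [Pi.single_eq_of_ne hk.ne]
        exact not_not.1 (not_exists.1 hfp i)
      obtain ⟨k, hk⟩ := (ht.eventually_mem (hU.mem_nhds hp)).exists
      have : f '' U = Set.univ := by
        refine Set.eq_univ_of_forall fun b => ?_
        by_cases hb : b
        · exact ⟨_, hk, by simp only [eq_true hb, eq_iff_iff, iff_true]; exact ⟨k, by simp⟩⟩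
        · exact ⟨p, hp, by simp only [eq_false hb, eq_iff_iff, iff_false]; exact hfp⟩
      rw [this]
      exact isOpen_univ
    · push Not at h
      rcases U.eq_empty_or_nonempty with rfl | ⟨p, hp⟩
      · simp
      · have : f '' U = {True} := by
          ext b
          exact ⟨fun ⟨q, hq, e⟩ => e ▸ eq_true (h q hq), fun e => ⟨p, hp, by
            rw [Set.mem_singleton_iff.1 e]; exact eq_true (h p hp)⟩⟩
        rw [this]
        exact isOpen_singleton_true
  have hq : Topology.IsQuotientMap fun p : (Set.univ : Set Baire) => f p := by
    refine (hfo.comp (isOpen_univ.isOpenMap_subtype_val)).isQuotientMap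
      ((continuous_Prop.2 hf).comp continuous_subtype_val) fun b => ?_
    by_cases hb : b
    · exact ⟨⟨fun _ => 1, trivial⟩, by simp [f, hb]⟩
    · exact ⟨⟨0, trivial⟩, by simp [f, hb]⟩
  refine .of_isQuotientMap hq ?_
  have hp := IsProjectiveSet.of_isOpen hf
  convert (hp.comp (f := fun t : Baire × Baire => t.1) (by fun_prop)).iff
    (hp.comp (f := fun t : Baire × Baire => t.2) (by fun_prop)) using 1
  ext t
  exact ⟨fun ⟨_, _, e⟩ => iff_of_eq e, fun e => ⟨trivial, trivial, propext e⟩⟩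

/-! ### Full subcategories closed under given limits and colimits -/

section FullSubcategory

variable {C : Type*} [Category C] {P : ObjectProperty C} {J : Type} [SmallCategory J]

theorem limitsOfShape_of_exists_limitCone
    (H : ∀ F : J ⥤ P.FullSubcategory, ∃ c : Cone (F ⋙ P.ι), Nonempty (IsLimit c) ∧ P c.pt) :
    HasLimitsOfShape J P.FullSubcategory ∧ PreservesLimitsOfShape J P.ι := by
  have key : ∀ F : J ⥤ P.FullSubcategory, HasLimit F ∧ PreservesLimit F P.ι := fun F => by
    obtain ⟨c, ⟨hc⟩, h⟩ := H F
    have : HasLimit (F ⋙ P.ι) := ⟨⟨c, hc⟩⟩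
    let := createsLimitFullSubcategoryInclusion' F hc h
    exact ⟨hasLimit_of_created F P.ι, inferInstance⟩
  exact ⟨⟨fun F => (key F).1⟩, ⟨fun {F} => (key F).2⟩⟩

theorem colimitsOfShape_of_exists_colimitCocone
    (H : ∀ F : J ⥤ P.FullSubcategory, ∃ c : Cocone (F ⋙ P.ι), Nonempty (IsColimit c) ∧ P c.pt) :
    HasColimitsOfShape J P.FullSubcategory ∧ PreservesColimitsOfShape J P.ι := by
  have key : ∀ F : J ⥤ P.FullSubcategory, HasColimit F ∧ PreservesColimit F P.ι := fun F => by
    obtain ⟨c, ⟨hc⟩, h⟩ := H F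
    have : HasColimit (F ⋙ P.ι) := ⟨⟨c, hc⟩⟩
    let := createsColimitFullSubcategoryInclusion' F hc h
    exact ⟨hasColimit_of_created F P.ι, inferInstance⟩
  exact ⟨⟨fun F => (key F).1⟩, ⟨fun {F} => (key F).2⟩⟩

theorem finiteLimits_of_terminal_of_pullbacks {T : C} (hT : IsTerminal T) (hPT : P T)
    (H : ∀ {X Y B : C} (f : X ⟶ B) (g : Y ⟶ B), P X → P Y → P B →
      ∃ c : PullbackCone f g, Nonempty (IsLimit c) ∧ P c.pt) :
    HasFiniteLimits P.FullSubcategory ∧ PreservesFiniteLimits P.ι := by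
  obtain ⟨h₁, h₂⟩ := limitsOfShape_of_exists_limitCone (P := P) (J := Discrete PEmpty) fun F =>
    ⟨_, ⟨isLimitChangeEmptyCone _ hT ⟨T, by cat_disch, by simp⟩ (Iso.refl _)⟩, hPT⟩
  obtain ⟨h₃, h₄⟩ := limitsOfShape_of_exists_limitCone (P := P) (J := WalkingCospan) fun F => by
    obtain ⟨c, ⟨hc⟩, h⟩ := H ((F ⋙ P.ι).map WalkingCospan.Hom.inl)
      ((F ⋙ P.ι).map WalkingCospan.Hom.inr) (F.obj _).2 (F.obj _).2 (F.obj _).2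
    exact ⟨_, ⟨(IsLimit.postcomposeInvEquiv (diagramIsoCospan (F ⋙ P.ι)) c).symm hc⟩, h⟩
  exact ⟨@hasFiniteLimits_of_hasTerminal_and_pullbacks _ _ h₁ h₃,
    @preservesFiniteLimits_of_preservesTerminal_and_pullbacks _ _ _ _ h₁ h₃ _ h₂ h₄⟩

theorem finiteColimits_of_initial_of_pushouts {T : C} (hT : IsInitial T) (hPT : P T)
    (H : ∀ {X Y B : C} (f : B ⟶ X) (g : B ⟶ Y), P X → P Y → P B →
      ∃ c : PushoutCocone f g, Nonempty (IsColimit c) ∧ P c.pt) :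
    HasFiniteColimits P.FullSubcategory ∧ PreservesFiniteColimits P.ι := by
  obtain ⟨h₁, h₂⟩ := colimitsOfShape_of_exists_colimitCocone (P := P) (J := Discrete PEmpty)
    fun F => ⟨_, ⟨isColimitChangeEmptyCocone _ hT ⟨T, by cat_disch, by simp⟩ (Iso.refl _)⟩, hPT⟩
  obtain ⟨h₃, h₄⟩ := colimitsOfShape_of_exists_colimitCocone (P := P) (J := WalkingSpan) fun F => by
    obtain ⟨c, ⟨hc⟩, h⟩ := H ((F ⋙ P.ι).map WalkingSpan.Hom.fst)
      ((F ⋙ P.ι).map WalkingSpan.Hom.snd) (F.obj _).2 (F.obj _).2 (F.obj _).2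
    exact ⟨_, ⟨(IsColimit.precomposeHomEquiv (diagramIsoSpan (F ⋙ P.ι)) c).symm hc⟩, h⟩
  exact ⟨@hasFiniteColimits_of_hasInitial_and_pushouts _ _ h₁ h₃,
    @preservesFiniteColimits_of_preservesInitial_and_pushouts _ _ _ _ h₁ h₃ _ h₂ h₄⟩

end FullSubcategory

/-! ### Morphisms of qcb₀-spaces -/

namespace QCB0

/-- A qcb₀-space as an object of the category. -/
abbrev of (X : Type) [TopologicalSpace X] (h : IsQCB0Space X) : QCB0 := ⟨TopCat.of X, h⟩

variable {X Y Z : QCB0}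

def ofHom (f : X.obj → Y.obj) (hf : Continuous f) : X ⟶ Y :=
  ObjectProperty.homMk (TopCat.ofHom ⟨f, hf⟩)

/-- The function underlying a morphism. -/
def fn (f : X ⟶ Y) : X.obj → Y.obj := f.hom.hom

theorem continuous_fn (f : X ⟶ Y) : Continuous (fn f) := f.hom.hom.continuous

theorem hom_ext {f g : X ⟶ Y} (h : ∀ x, fn f x = fn g x) : f = g :=
  ObjectProperty.hom_ext _ (TopCat.ext h)

theorem congr_fn {f g : X ⟶ Y} (h : f = g) (x : X.obj) : fn f x = fn g x := h ▸ rfl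

/-- The one-point space. -/
def point : QCB0 := of PUnit (isQCB0Space_of_secondCountable _)

def const (x : Y.obj) : X ⟶ Y := ofHom (fun _ => x) continuous_const

def isTerminalPoint : IsTerminal point :=
  IsTerminal.ofUniqueHom (fun _ => const PUnit.unit) fun _ _ => hom_ext fun _ => rfl

def empty : QCB0 := of PEmpty (isQCB0Space_of_secondCountable _)

def isInitialEmpty : IsInitial empty :=
  IsInitial.ofUniqueHom (fun _ => ofHom (fun x => x.elim) (continuous_of_const fun x => x.elim))
    fun _ _ => hom_ext fun x => x.elim

def fanFst (c : BinaryFan X Y) (t : c.pt.obj) : X.obj := fn (Y := X) c.fst t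

def fanSnd (c : BinaryFan X Y) (t : c.pt.obj) : Y.obj := fn (Y := Y) c.snd t

/-- Points are morphisms from `point`, so every categorical product has the cartesian product as its
set of points. -/
theorem binaryFan_ext {c : BinaryFan X Y} (hc : IsLimit c) {t t' : c.pt.obj}
    (h₁ : fanFst c t = fanFst c t') (h₂ : fanSnd c t = fanSnd c t') : t = t' := by
  have : (const t : point ⟶ c.pt) = const t' :=
    BinaryFan.IsLimit.hom_ext hc (hom_ext fun _ => h₁) (hom_ext fun _ => h₂)
  exact congr_fn this PUnit.unit

theorem exists_binaryFan_lift {c : BinaryFan X Y} (hc : IsLimit c) (f : Z ⟶ X) (g : Z ⟶ Y) :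
    ∃ l : Z ⟶ c.pt, (∀ z, fanFst c (fn l z) = fn f z) ∧ ∀ z, fanSnd c (fn l z) = fn g z := by
  obtain ⟨l, h₁, h₂⟩ := BinaryFan.IsLimit.lift' hc f g
  exact ⟨l, fun z => congr_fn h₁ z, fun z => congr_fn h₂ z⟩

theorem exists_binaryFan_point {c : BinaryFan X Y} (hc : IsLimit c) (x : X.obj) (y : Y.obj) :
    ∃ t : c.pt.obj, fanFst c t = x ∧ fanSnd c t = y :=
  let ⟨l, h₁, h₂⟩ := exists_binaryFan_lift hc (const x : point ⟶ X) (const y)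
  ⟨fn l PUnit.unit, h₁ _, h₂ _⟩

theorem fn_lift_fst {c : BinaryFan X Y} (hc : IsLimit c) (f : Z ⟶ X) (g : Z ⟶ Y) (z : Z.obj) :
    fanFst c (fn (hc.lift (BinaryFan.mk f g)) z) = fn f z :=
  congr_fn (hc.fac (BinaryFan.mk f g) ⟨WalkingPair.left⟩) z

theorem fn_lift_snd {c : BinaryFan X Y} (hc : IsLimit c) (f : Z ⟶ X) (g : Z ⟶ Y) (z : Z.obj) :
    fanSnd c (fn (hc.lift (BinaryFan.mk f g)) z) = fn g z :=
  congr_fn (hc.fac (BinaryFan.mk f g) ⟨WalkingPair.right⟩) z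

/-- A criterion for exponentials in terms of points. -/
theorem isExponential_of_points {E : QCB0} (c : BinaryFan E X) (hc : IsLimit c) (ev : c.pt ⟶ Y)
    (app : E.obj → X.obj → Y.obj) (hev : ∀ t, fn ev t = app (fanFst c t) (fanSnd c t))
    (hinj : ∀ e e', (∀ x, app e x = app e' x) → e = e')
    (hcurry : ∀ (Z : QCB0) (d : BinaryFan Z X) (_ : IsLimit d) (f : d.pt ⟶ Y),
      ∃ g : Z.obj → E.obj, Continuous g ∧ ∀ t, app (g (fanFst d t)) (fanSnd d t) = (fn f t : Y.obj)) :
    IsExponential X Y E := by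
  have key : ∀ {Z : QCB0} (d : BinaryFan Z X) (g : Z ⟶ E) (t : d.pt.obj),
      fn (hc.lift (BinaryFan.mk (d.fst ≫ g) d.snd) ≫ ev) t =
        app (fn g (fanFst d t)) (fanSnd d t) := by
    intro Z d g t
    exact (hev _).trans (congrArg₂ app (fn_lift_fst hc _ _ t) (fn_lift_snd hc _ _ t))
  refine ⟨c, hc, ev, fun Z d hd f => ?_⟩
  obtain ⟨g, hg, h⟩ := hcurry Z d hd f
  refine ⟨ofHom g hg, hom_ext fun t => ?_, fun g' hg' => hom_ext fun z => hinj _ _ fun x => ?_⟩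
  · exact (key d _ t).trans (h t)
  · obtain ⟨t, rfl, rfl⟩ := exists_binaryFan_point hd z x
    exact (key d g' t).symm.trans ((congr_fn hg' t).trans (h t).symm)

end QCB0

/-! ### The category of projective qcb₀-spaces -/

open QCB0

theorem projectiveQCB0_iff {X : QCB0} : projectiveQCB0 X ↔ IsProjectiveSpace X.obj :=
  ⟨fun ⟨n, D, δ, h, hn⟩ => ⟨X.2, D, δ, h, n, hn⟩, fun ⟨_, D, δ, h, n, hn⟩ => ⟨n, D, δ, h, hn⟩⟩

instance : projectiveQCB0.IsClosedUnderIsomorphisms where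
  of_iso {X Y} e hX := by
    rw [projectiveQCB0_iff] at hX ⊢
    obtain ⟨r⟩ := hX.nonempty_projRep
    have := Y.2.1
    have he : Topology.IsQuotientMap (fn e.hom) :=
      .of_inverse (f := fn e.inv) (continuous_fn _) (continuous_fn _)
        fun y => congr_fn e.inv_hom_id y
    refine .of_isQuotientMap (he.comp r.isQuotientMap) ?_
    convert r.proj using 1
    ext t
    refine ⟨fun ⟨h, h', E⟩ => ⟨h, h', ?_⟩,
      fun ⟨h, h', E⟩ => ⟨h, h', congrArg (fn e.hom) E⟩⟩
    exact Function.LeftInverse.injective (f := fn e.hom) (fun x => congr_fn e.hom_inv_id x) E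

theorem exists_isExponential_projective {X Y : QCB0} (hX : projectiveQCB0 X)
    (hY : projectiveQCB0 Y) : ∃ E, projectiveQCB0 E ∧ IsExponential X Y E := by
  rw [projectiveQCB0_iff] at hX hY
  obtain ⟨rX⟩ := hX.nonempty_projRep
  obtain ⟨rY⟩ := hY.nonempty_projRep
  have hEp := ProjRep.exp_isProjectiveSpace rX rY
  obtain ⟨rE⟩ := hEp.nonempty_projRep
  obtain ⟨r1⟩ := isProjectiveSpace_punit.nonempty_projRep
  -- The product with the exponential is the pullback over the one-point space.
  have hPp := ProjRep.pullback_isProjectiveSpace (rX := rE) (rY := rX) (f := fun _ => PUnit.unit)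
    (g := fun _ => PUnit.unit) r1 continuous_const continuous_const
  let E : QCB0 := of _ hEp.1
  let Q : QCB0 := of _ hPp.1
  let c : BinaryFan E X := BinaryFan.mk (P := Q) (ofHom _ ProjRep.Pullback.continuous_fst)
    (ofHom _ ProjRep.Pullback.continuous_snd)
  have hc : IsLimit c := BinaryFan.isLimitMk
    (fun s => ofHom (Y := Q) (fun z => ⟨fn s.fst z, fn s.snd z, rfl⟩)
      (ProjRep.Pullback.continuous_mk s.pt.2 (continuous_fn s.fst) (continuous_fn s.snd)))
    (fun _ => rfl) (fun _ => rfl)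
    fun s m h₁ h₂ => hom_ext fun z => ProjRep.Pullback.ext (congr_fn h₁ z) (congr_fn h₂ z)
  let ev : c.pt ⟶ Y := ofHom (X := Q) (fun t => t.fst.toFun t.snd) <| by
    refine ProjRep.pullbackRep_isQuotientMap.continuous_iff.2 ?_
    exact (continuous_eval_of_isQuotientMap (φ := fun (e : ProjRep.Exp rX rY) w =>
      e.toFun (rX.rep w)) (ProjRep.expRep_isQuotientMap rX rY)
      (ProjRep.continuous_expRep_apply rX rY) rE.continuous).comp
      (((Baire.continuous_evens.comp continuous_subtype_val).subtype_mk fun p => p.2.1).prodMk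
        ((Baire.continuous_odds.comp continuous_subtype_val).subtype_mk fun p => p.2.2.1))
  refine ⟨E, projectiveQCB0_iff.2 hEp, isExponential_of_points c hc ev
    (fun e : ProjRep.Exp rX rY => e.toFun) (fun _ => rfl)
    (fun e e' h => ProjRep.Exp.ext (funext h)) fun Z d hd f => ?_⟩
  -- The morphism `j z` is the slice of the product at `z`, so `f` after `j z` is the value of the
  -- curried map. Its continuity in `z` is tested on names, through the map `l` that pairs `π` with
  -- `rX.rep`.
  choose j hj₁ hj₂ using fun z => exists_binaryFan_lift hd (const z) (𝟙 X)
  refine ⟨fun z => ⟨fun x => fn f (fn (j z) x), (continuous_fn f).comp (continuous_fn (j z))⟩,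
    ?_, fun t => congrArg (fn f) (binaryFan_ext hd (hj₁ _ _) (hj₂ _ _))⟩
  obtain ⟨D, π, hπ⟩ := Z.2.exists_isQuotientMap
  obtain ⟨l, hl₁, hl₂⟩ := exists_binaryFan_lift hd
    (ofHom (X := of (D × rX.dom) (isQCB0Space_of_secondCountable _)) (fun t => π t.1)
      (hπ.continuous.comp continuous_fst))
    (ofHom (fun t => rX.rep t.2) (rX.continuous.comp continuous_snd))
  refine hπ.continuous_iff.2 (ProjRep.exists_curry rX rY ((continuous_fn f).comp (continuous_fn l))
    fun z x => congrArg (fn f) (binaryFan_ext hd ?_ ?_)).1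
  · rw [hl₁, hj₁]; rfl
  · rw [hl₂, hj₂]; rfl

theorem inheritsFiniteStructure_projectiveQCB0 : InheritsFiniteStructure projectiveQCB0 := by
  obtain ⟨h₁, h₂⟩ := finiteLimits_of_terminal_of_pullbacks (P := projectiveQCB0) isTerminalPoint
    (projectiveQCB0_iff.2 isProjectiveSpace_punit) fun {X Y B} f g hX hY hB => by
      rw [projectiveQCB0_iff] at hX hY hB
      obtain ⟨rX⟩ := hX.nonempty_projRep
      obtain ⟨rY⟩ := hY.nonempty_projRep
      obtain ⟨rB⟩ := hB.nonempty_projRep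
      have hQ := ProjRep.pullback_isProjectiveSpace (rX := rX) (rY := rY) rB (continuous_fn f)
        (continuous_fn g)
      let Q : QCB0 := of _ hQ.1
      refine ⟨PullbackCone.mk (W := Q) (ofHom _ ProjRep.Pullback.continuous_fst)
        (ofHom _ ProjRep.Pullback.continuous_snd) (hom_ext fun z => z.eq),
        ⟨PullbackCone.IsLimit.mk _ (fun s => ofHom (Y := Q)
          (fun z => ⟨fn s.fst z, fn s.snd z, congr_fn s.condition z⟩)
          (ProjRep.Pullback.continuous_mk s.pt.2 (continuous_fn s.fst) (continuous_fn s.snd)))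
        (fun _ => rfl) (fun _ => rfl) fun s m h₁ h₂ => hom_ext fun z =>
          ProjRep.Pullback.ext (congr_fn h₁ z) (congr_fn h₂ z)⟩, projectiveQCB0_iff.2 hQ⟩
  obtain ⟨h₃, h₄⟩ := finiteColimits_of_initial_of_pushouts (P := projectiveQCB0) isInitialEmpty
    (projectiveQCB0_iff.2 isProjectiveSpace_pempty) fun {X Y B} f g hX hY hB => by
      rw [projectiveQCB0_iff] at hX hY hB
      obtain ⟨rX⟩ := hX.nonempty_projRep
      obtain ⟨rY⟩ := hY.nonempty_projRep
      obtain ⟨rB⟩ := hB.nonempty_projRep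
      have hQ := QCBPushout.isProjectiveSpace rX rY rB (continuous_fn f) (continuous_fn g)
      let Q : QCB0 := of _ hQ.1
      have hd : ∀ s : PushoutCocone f g, ∃ u : Q ⟶ s.pt,
          (∀ x, fn u (QCBPushout.mk _ _ (.inl x)) = fn s.inl x) ∧
          ∀ y, fn u (QCBPushout.mk _ _ (.inr y)) = fn s.inr y := fun s => by
        have := s.pt.2.1
        obtain ⟨u, hu, h⟩ := QCBPushout.exists_desc (f := fn f) (g := fn g)
          (continuous_fn s.inl) (continuous_fn s.inr) (congr_fn s.condition)
        exact ⟨ofHom u hu, h⟩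
      choose u hu₁ hu₂ using hd
      refine ⟨PushoutCocone.mk (W := Q)
        (ofHom _ (QCBPushout.mk_isQuotientMap.continuous.comp continuous_inl))
        (ofHom _ (QCBPushout.mk_isQuotientMap.continuous.comp continuous_inr))
        (hom_ext fun z => QCBPushout.mk_inl_eq_mk_inr z),
        ⟨PushoutCocone.IsColimit.mk _ u (fun s => hom_ext (hu₁ s)) (fun s => hom_ext (hu₂ s))
          fun s m h₁ h₂ => hom_ext fun q => ?_⟩, projectiveQCB0_iff.2 hQ⟩
      obtain ⟨x | y, rfl⟩ := QCBPushout.mk_isQuotientMap.surjective q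
      · exact (congr_fn h₁ x).trans (hu₁ s x).symm
      · exact (congr_fn h₂ y).trans (hu₂ s y).symm
  exact ⟨fun X Y => exists_isExponential_projective, h₁, h₂, h₃, h₄⟩

/-! ### Iso-closures of full subcategories that inherit finite structure -/

section IsoClosure

variable {C : Type*} [Category C] {P : ObjectProperty C}

theorem comp_comp_inv_eq_iff {A B Y Y₀ : C} (l : A ⟶ B) (s : B ⟶ Y₀) (e : Y ≅ Y₀) (f : A ⟶ Y) :
    l ≫ s ≫ e.inv = f ↔ l ≫ s = f ≫ e.hom := by
  rw [← Category.assoc, Iso.comp_inv_eq]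

/-- A full subcategory is equivalent to its closure under isomorphism. This permits working with the
closure although `P` itself need not be closed. -/
theorem exists_lift_of_isoClosure {J : Type} [SmallCategory J] (F : J ⥤ C)
    (hF : ∀ j, P.isoClosure (F.obj j)) :
    ∃ F' : J ⥤ P.FullSubcategory, Nonempty (F' ⋙ P.ι ≅ F) := by
  let E := ObjectProperty.ιOfLE P.le_isoClosure
  have : E.IsEquivalence := (ObjectProperty.isEquivalence_ιOfLE_iff _).2 le_rfl
  exact ⟨P.isoClosure.lift F hF ⋙ E.inv, ⟨Functor.isoWhiskerLeft (P.isoClosure.lift F hF)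
    (Functor.isoWhiskerRight E.asEquivalence.counitIso P.isoClosure.ι)⟩⟩

namespace InheritsFiniteStructure

variable (hP : InheritsFiniteStructure P)

include hP

theorem limit_mem {J : Type} [SmallCategory J] [FinCategory J] (F : J ⥤ C)
    (hF : ∀ j, P.isoClosure (F.obj j)) {c : Cone F} (hc : IsLimit c) : P.isoClosure c.pt := by
  obtain ⟨F', ⟨α⟩⟩ := exists_lift_of_isoClosure F hF
  have := hP.hasFiniteLimits
  have := hP.preservesFiniteLimits
  exact ⟨_, (limit F').property, ⟨(IsLimit.conePointsIsoOfNatIso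
    (isLimitOfPreserves P.ι (limit.isLimit F')) hc α).symm⟩⟩

theorem colimit_mem {J : Type} [SmallCategory J] [FinCategory J] (F : J ⥤ C)
    (hF : ∀ j, P.isoClosure (F.obj j)) {c : Cocone F} (hc : IsColimit c) :
    P.isoClosure c.pt := by
  obtain ⟨F', ⟨α⟩⟩ := exists_lift_of_isoClosure F hF
  have := hP.hasFiniteColimits
  have := hP.preservesFiniteColimits
  exact ⟨_, (colimit F').property, ⟨(IsColimit.coconePointsIsoOfNatIso
    (isColimitOfPreserves P.ι (colimit.isColimit F')) hc α).symm⟩⟩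

theorem exists_colimit {J : Type} [SmallCategory J] [FinCategory J] (F : J ⥤ C)
    (hF : ∀ j, P.isoClosure (F.obj j)) : HasColimit F := by
  obtain ⟨F', ⟨α⟩⟩ := exists_lift_of_isoClosure F hF
  have := hP.hasFiniteColimits
  have := hP.preservesFiniteColimits
  have : HasColimit (F' ⋙ P.ι) := ⟨⟨_, isColimitOfPreserves P.ι (colimit.isColimit F')⟩⟩
  exact hasColimit_of_iso α.symm

theorem pullback_mem {X Y B : C} {f : X ⟶ B} {g : Y ⟶ B} (hX : P.isoClosure X)
    (hY : P.isoClosure Y) (hB : P.isoClosure B) {c : PullbackCone f g} (hc : IsLimit c) :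
    P.isoClosure c.pt :=
  hP.limit_mem (cospan f g) (by rintro (_ | _ | _) <;> assumption) hc

theorem product_mem {X Y : C} (hX : P.isoClosure X) (hY : P.isoClosure Y) {c : BinaryFan X Y}
    (hc : IsLimit c) : P.isoClosure c.pt :=
  hP.limit_mem (pair X Y) (by rintro ⟨_ | _⟩ <;> assumption) hc

theorem terminal_mem {T : C} (hT : IsTerminal T) : P.isoClosure T :=
  hP.limit_mem (Functor.empty C) (fun j => j.as.elim) hT

theorem pushout_mem {X Y B : C} {f : B ⟶ X} {g : B ⟶ Y} (hX : P.isoClosure X)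
    (hY : P.isoClosure Y) (hB : P.isoClosure B) {c : PushoutCocone f g} (hc : IsColimit c) :
    P.isoClosure c.pt :=
  hP.colimit_mem (span f g) (by rintro (_ | _ | _) <;> assumption) hc

theorem exists_pushout {X Y B : C} (f : B ⟶ X) (g : B ⟶ Y) (hX : P.isoClosure X)
    (hY : P.isoClosure Y) (hB : P.isoClosure B) :
    ∃ c : PushoutCocone f g, Nonempty (IsColimit c) ∧ P.isoClosure c.pt := by
  have := hP.exists_colimit (span f g) (by rintro (_ | _ | _) <;> assumption)
  exact ⟨_, ⟨colimit.isColimit (span f g)⟩, hP.pushout_mem hX hY hB (colimit.isColimit (span f g))⟩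

theorem exists_exponential {X Y : C} (hX : P.isoClosure X) (hY : P.isoClosure Y) :
    ∃ E, P.isoClosure E ∧ IsExponential X Y E := by
  obtain ⟨X₀, hX₀, ⟨e⟩⟩ := hX
  obtain ⟨Y₀, hY₀, ⟨e'⟩⟩ := hY
  obtain ⟨E, hE, c, hc, ev, H⟩ := hP.exponentials X₀ Y₀ hX₀ hY₀
  refine ⟨E, P.le_isoClosure _ hE, BinaryFan.mk c.fst (c.snd ≫ e.inv),
    BinaryFan.isLimitCompRightIso c e.inv hc, ev ≫ e'.inv, fun Z d hd f => ?_⟩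
  obtain ⟨g, hg, hu⟩ := H Z (BinaryFan.mk d.fst (d.snd ≫ e.hom))
    (BinaryFan.isLimitCompRightIso d e.hom hd) (f ≫ e'.hom)
  have key : ∀ g : Z ⟶ E, (BinaryFan.isLimitCompRightIso c e.inv hc).lift
      (BinaryFan.mk (d.fst ≫ g) d.snd) =
      hc.lift (BinaryFan.mk (d.fst ≫ g) (d.snd ≫ e.hom)) := by
    intro g
    refine BinaryFan.IsLimit.hom_ext hc ?_ ?_
    · exact ((BinaryFan.isLimitCompRightIso c e.inv hc).fac (BinaryFan.mk (d.fst ≫ g) d.snd)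
        ⟨WalkingPair.left⟩).trans (hc.fac (BinaryFan.mk (d.fst ≫ g) (d.snd ≫ e.hom))
        ⟨WalkingPair.left⟩).symm
    · have h₁ := (BinaryFan.isLimitCompRightIso c e.inv hc).fac (BinaryFan.mk (d.fst ≫ g) d.snd)
        ⟨WalkingPair.right⟩
      have h₂ := hc.fac (BinaryFan.mk (d.fst ≫ g) (d.snd ≫ e.hom)) ⟨WalkingPair.right⟩
      exact ((comp_comp_inv_eq_iff _ _ e _).1 h₁).trans h₂.symm
  refine ⟨g, ?_, fun g' hg' => hu g' ?_⟩
  · exact (comp_comp_inv_eq_iff _ _ e' _).2 ((congrArg (· ≫ ev) (key g)).trans hg)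
  · exact (congrArg (· ≫ ev) (key g')).symm.trans ((comp_comp_inv_eq_iff _ _ e' _).1 hg')

end InheritsFiniteStructure

end IsoClosure

/-! ### Countably based objects and the points of exponentials -/

namespace QCB0

/-- The object of a countably based `T₀`-space. -/
abbrev cb (X : Type) [TopologicalSpace X] [T0Space X] [SecondCountableTopology X] : QCB0 :=
  of X (isQCB0Space_of_secondCountable X)

variable {X Y : Type} [TopologicalSpace X] [T0Space X] [SecondCountableTopology X]
  [TopologicalSpace Y] [T0Space Y] [SecondCountableTopology Y]

variable (X Y) in
def cbProd : BinaryFan (cb X) (cb Y) :=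
  BinaryFan.mk (P := cb (X × Y)) (ofHom Prod.fst continuous_fst) (ofHom Prod.snd continuous_snd)

def cbProdIsLimit : IsLimit (cbProd X Y) :=
  BinaryFan.isLimitMk
    (fun s => ofHom (Y := cb (X × Y)) (fun z => (fn s.fst z, fn s.snd z))
      ((continuous_fn s.fst).prodMk (continuous_fn s.snd)))
    (fun _ => rfl) (fun _ => rfl)
    fun _ _ h₁ h₂ => hom_ext fun z => Prod.ext (congr_fn h₁ z) (congr_fn h₂ z)

def cbIso (e : X ≃ₜ Y) : cb X ≅ cb Y where
  hom := ofHom e e.continuous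
  inv := ofHom e.symm e.symm.continuous
  hom_inv_id := hom_ext e.symm_apply_apply
  inv_hom_id := hom_ext e.apply_symm_apply

/-- Exponentials of qcb₀-spaces are spaces of functions. -/
theorem IsExponential.exists_app {X Y E : QCB0} (h : IsExponential X Y E) :
    ∃ app : E.obj → X.obj → Y.obj,
      (∀ {Z : QCB0} (u : Z ⟶ E) (k : Z ⟶ X), Continuous fun z => app (fn u z) (fn k z)) ∧
      (∀ e e', (∀ x, app e x = app e' x) → e = e') ∧
      (∀ {Z : QCB0} {d : BinaryFan Z X} (_ : IsLimit d) (f : d.pt ⟶ Y),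
        ∃ g : Z ⟶ E, ∀ t, app (fn g (fanFst d t)) (fanSnd d t) = (fn f t : Y.obj)) ∧
      ∃ c : BinaryFan E X, Nonempty (IsLimit c) := by
  obtain ⟨c, hc, ev, H⟩ := h
  choose pt hp₁ hp₂ using fun e x => exists_binaryFan_point hc e x
  have hl : ∀ {Z : QCB0} (u : Z ⟶ E) (k : Z ⟶ X) z,
      fn (hc.lift (BinaryFan.mk u k)) z = pt (fn u z) (fn k z) := fun u k z =>
    binaryFan_ext hc ((fn_lift_fst hc u k z).trans (hp₁ _ _).symm)
      ((fn_lift_snd hc u k z).trans (hp₂ _ _).symm)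
  have hcurry : ∀ {Z : QCB0} {d : BinaryFan Z X} (g : Z ⟶ E) t,
      (fn (hc.lift (BinaryFan.mk (d.fst ≫ g) d.snd) ≫ ev) t : Y.obj) =
        fn ev (pt (fn g (fanFst d t)) (fanSnd d t)) := fun g t => congrArg (fn ev) (hl _ _ t)
  refine ⟨fun e x => fn ev (pt e x), fun u k => ?_, fun e e' he => ?_, fun {Z d} hd f => ?_,
    c, ⟨hc⟩⟩
  · simp only [← hl]
    exact (continuous_fn ev).comp (continuous_fn (hc.lift (BinaryFan.mk u k)))
  · let d : BinaryFan point X := BinaryFan.mk (const PUnit.unit) (𝟙 X)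
    have hd : IsLimit d := BinaryFan.isLimitMk (fun s => s.snd) (fun _ => hom_ext fun _ => rfl)
      (fun _ => Category.comp_id _) fun _ _ _ h => (Category.comp_id _).symm.trans h
    obtain ⟨g, -, hg⟩ := H point d hd (hc.lift (BinaryFan.mk (d.fst ≫ const e) d.snd) ≫ ev)
    have := (hg (const e) rfl).trans (hg (const e') (hom_ext fun t =>
      (hcurry _ t).trans ((he _).symm.trans (hcurry (const e) t).symm))).symm
    exact congr_fn this PUnit.unit
  · obtain ⟨g, hg, -⟩ := H Z d hd f
    exact ⟨g, fun t => (hcurry g t).symm.trans (congr_fn hg t)⟩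

end QCB0

theorem QCB0.isExponential_baire : IsExponential omegaQCB0 omegaQCB0 (cb Baire) := by
  have hev : Continuous fun t : Baire × ℕ => t.1 t.2 := by
    refine continuous_discrete_rng.2 fun v => ?_
    have : (fun t : Baire × ℕ => t.1 t.2) ⁻¹' {v} = ⋃ n, {t | t.1 n = v} ∩ {t | t.2 = n} := by
      ext t; simp
    rw [this]
    exact isOpen_iUnion fun n => ((isOpen_discrete {v}).preimage
      (f := fun t : Baire × ℕ => t.1 n) (by fun_prop)).inter
      ((isOpen_discrete {n}).preimage (f := fun t : Baire × ℕ => t.2) (by fun_prop))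
  refine isExponential_of_points (cbProd Baire ℕ) cbProdIsLimit
    (ofHom (X := cb (Baire × ℕ)) (Y := omegaQCB0) (fun t => t.1 t.2) hev)
    (fun e n => e n) (fun _ => rfl) (fun e e' h => funext h) fun Z d hd f => ?_
  choose j hj₁ hj₂ using fun n : ℕ => exists_binaryFan_lift hd (𝟙 Z) (const (Y := omegaQCB0) n)
  exact ⟨fun z n => fn f (fn (j n) z),
    continuous_pi fun n => (continuous_fn f).comp (continuous_fn (j n)),
    fun t => congrArg (fn f) (binaryFan_ext hd (hj₁ _ _) (hj₂ _ _))⟩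

theorem QCB0.IsExponential.nonempty_iso {X Y E E' : QCB0} (h : IsExponential X Y E)
    (h' : IsExponential X Y E') : Nonempty (E ≅ E') := by
  obtain ⟨app, hc, hinj, hcurry, c, ⟨hcl⟩⟩ := exists_app h
  obtain ⟨app', hc', hinj', hcurry', c', ⟨hcl'⟩⟩ := exists_app h'
  obtain ⟨g, hg⟩ := hcurry hcl' (ofHom (fun t => app' (fanFst c' t) (fanSnd c' t))
    (hc' (Z := c'.pt) c'.fst c'.snd))
  obtain ⟨g', hg'⟩ := hcurry' hcl (ofHom (fun t => app (fanFst c t) (fanSnd c t))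
    (hc (Z := c.pt) c.fst c.snd))
  have H : ∀ e x, app (fn g e) x = app' e x := fun e x => by
    obtain ⟨t, rfl, rfl⟩ := exists_binaryFan_point hcl' e x
    exact hg t
  have H' : ∀ e x, app' (fn g' e) x = app e x := fun e x => by
    obtain ⟨t, rfl, rfl⟩ := exists_binaryFan_point hcl e x
    exact hg' t
  exact ⟨⟨g', g, hom_ext fun e => hinj _ _ fun x => (H _ x).trans (H' e x),
    hom_ext fun e => hinj' _ _ fun x => (H' _ x).trans (H e x)⟩⟩

/-! ### Countably based spaces in a subcategory that inherits finite structure -/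

namespace InheritsFiniteStructure

variable {P : ObjectProperty QCB0} (hP : InheritsFiniteStructure P)
  {X Y : Type} [TopologicalSpace X] [T0Space X] [SecondCountableTopology X]
  [TopologicalSpace Y] [T0Space Y] [SecondCountableTopology Y]

theorem cb_of_homeomorph (e : X ≃ₜ Y) (hX : P.isoClosure (cb X)) : P.isoClosure (cb Y) :=
  P.isoClosure.prop_of_iso (cbIso e) hX

include hP

theorem cb_prod (hX : P.isoClosure (cb X)) (hY : P.isoClosure (cb Y)) :
    P.isoClosure (cb (X × Y)) :=
  hP.product_mem hX hY cbProdIsLimit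

theorem cb_of_isOpen (hS : P.isoClosure sierpinskiQCB0) (hX : P.isoClosure (cb X)) {U : Set X}
    (hU : IsOpen U) : P.isoClosure (cb U) := by
  let χ : cb X ⟶ sierpinskiQCB0 := ofHom (fun x => x ∈ U) (continuous_Prop.2 hU)
  let t : point ⟶ sierpinskiQCB0 := const (Y := sierpinskiQCB0) True
  have hs : ∀ (s : PullbackCone χ t) z, fn s.fst z ∈ U := fun s z =>
    of_eq_true (congr_fn s.condition z)
  exact hP.pullback_mem (f := χ) (g := t) hX (hP.terminal_mem isTerminalPoint) hS
    (c := PullbackCone.mk (W := cb U) (ofHom Subtype.val continuous_subtype_val)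
      (const PUnit.unit) (hom_ext fun x => eq_true x.2))
    (PullbackCone.IsLimit.mk _
      (fun s => ofHom (fun z => (⟨fn s.fst z, hs s z⟩ : U)) ((continuous_fn s.fst).subtype_mk _))
      (fun _ => rfl) (fun _ => hom_ext fun _ => rfl)
      fun s m h₁ _ => hom_ext fun z => Subtype.ext (congr_fn h₁ z))

/-- A point `y` belongs to the set exactly when `x ↦ (x, y)` factors through `B`. So the set is the
pullback of `φ : Y → (X × Y) ^ X` along the map `ψ : B ^ X → (X × Y) ^ X` induced by the inclusion.
The projection `ι` to `B ^ X` is continuous by currying, hence the pullback has the subspace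
topology. -/
theorem cb_setOf_forall (hX : P.isoClosure (cb X)) (hY : P.isoClosure (cb Y)) {B : Set (X × Y)}
    (hB : P.isoClosure (cb B)) : P.isoClosure (cb {y | ∀ x, (x, y) ∈ B}) := by
  obtain ⟨E, hE, hexp⟩ := hP.exists_exponential hX hB
  obtain ⟨E', hE', hexp'⟩ := hP.exists_exponential hX (hP.cb_prod hX hY)
  obtain ⟨app, hc, hinj, hcurry, c, ⟨hcl⟩⟩ := hexp.exists_app
  obtain ⟨app', -, hinj', hcurry', -⟩ := hexp'.exists_app
  obtain ⟨φ, hφ⟩ := hcurry' (cbProdIsLimit (X := Y) (Y := X))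
    (ofHom (X := cb (Y × X)) (Y := cb (X × Y)) Prod.swap continuous_swap)
  obtain ⟨ψ, hψ⟩ := hcurry' hcl (ofHom (Y := cb (X × Y))
    (fun t => (app (fanFst c t) (fanSnd c t) : B).1)
    (continuous_subtype_val.comp (hc (Z := c.pt) c.fst c.snd)))
  let A : Set Y := {y | ∀ x, (x, y) ∈ B}
  obtain ⟨ι, hι⟩ := hcurry (cbProdIsLimit (X := A) (Y := X))
    (ofHom (X := cb (A × X)) (Y := cb B) (fun t => ⟨(t.2, t.1.1), t.1.2 t.2⟩)
    ((continuous_snd.prodMk (continuous_subtype_val.comp continuous_fst)).subtype_mk _))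
  have hφ' : ∀ (y : Y) (x : X), (app' (fn φ y) x : X × Y) = (x, y) := fun y x => hφ (y, x)
  have hψ' : ∀ e (x : X), (app' (fn ψ e) x : X × Y) = (app e x : B).1 := fun e x => by
    obtain ⟨t, rfl, rfl⟩ := exists_binaryFan_point hcl e x
    exact hψ t
  have hι' : ∀ (y : A) (x : X), (app (fn ι y) x : B).1 = (x, y.1) := fun y x =>
    congrArg Subtype.val (hι (y, x))
  have hs : ∀ (s : PullbackCone φ ψ) z (x : X), (x, (fn s.fst z : Y)) = (app (fn s.snd z) x : B).1 :=
    fun s z x => (hφ' _ _).symm.trans ((congrArg (app' · x) (congr_fn s.condition z)).trans (hψ' _ _))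
  have hsA : ∀ (s : PullbackCone φ ψ) z, fn s.fst z ∈ A := fun s z x => by
    rw [hs s z x]
    exact Subtype.property _
  exact hP.pullback_mem (f := φ) (g := ψ) hY hE hE'
    (c := PullbackCone.mk (W := cb A) (ofHom Subtype.val continuous_subtype_val) ι
      (hom_ext fun y => hinj' _ _ fun x => (hφ' _ _).trans ((hψ' _ _).trans (hι' y x)).symm))
    (PullbackCone.IsLimit.mk _
      (fun s => ofHom (fun z => (⟨fn s.fst z, hsA s z⟩ : A)) ((continuous_fn s.fst).subtype_mk _))
      (fun _ => rfl)
      (fun s => hom_ext fun z => hinj _ _ fun x => Subtype.ext ((hι' _ x).trans (hs s z x)))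
      fun s m h₁ _ => hom_ext fun z => Subtype.ext (congr_fn h₁ z))

/-- A point is outside `A` when it differs from every point of `A`, and inequality is open in a
Hausdorff space. -/
theorem cb_compl [T2Space X] (hS : P.isoClosure sierpinskiQCB0) (hX : P.isoClosure (cb X))
    {A : Set X} (hA : P.isoClosure (cb A)) : P.isoClosure (cb (Aᶜ : Set X)) := by
  have hW : IsOpen {t : A × X | (t.1 : X) ≠ t.2} :=
    isOpen_ne_fun (continuous_subtype_val.comp continuous_fst) continuous_snd
  have h := hP.cb_setOf_forall hA hX (hP.cb_of_isOpen hS (hP.cb_prod hA hX) hW)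
  refine cb_of_homeomorph (Homeomorph.setCongr ?_) h
  ext x
  exact ⟨fun h hx => h ⟨x, hx⟩ rfl, fun h a e => h (show x ∈ A from (show a.1 = x from e) ▸ a.2)⟩

/-- The range is the equalizer of the cokernel pair of `f`. Folding the two copies of `X` shows that
only equal points are glued; a point `x` off the range is not glued, since the open set `{x}ᶜ` on
one copy and the whole space on the other agree along `f`. -/
theorem cb_range [T1Space X] (hX : P.isoClosure (cb X)) (hY : P.isoClosure (cb Y)) {f : Y → X}
    (hf : Continuous f) : P.isoClosure (cb (Set.range f)) := by
  let F : cb Y ⟶ cb X := ofHom f hf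
  obtain ⟨c, ⟨hc⟩, hcP⟩ := hP.exists_pushout F F hX hX hY
  have hdesc : ∀ {T : QCB0} (h k : cb X ⟶ T), F ≫ h = F ≫ k → ∃ u : c.pt ⟶ T,
      (∀ x : X, fn u (fn c.inl x) = fn h x) ∧ ∀ x : X, fn u (fn c.inr x) = fn k x := fun h k e =>
    ⟨PushoutCocone.IsColimit.desc hc h k e,
      fun x => congr_fn (PushoutCocone.IsColimit.inl_desc hc h k e) x,
      fun x => congr_fn (PushoutCocone.IsColimit.inr_desc hc h k e) x⟩
  have heq : ∀ x y : X, fn c.inl x = fn c.inr y → x = y := fun x y e => by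
    obtain ⟨u, h₁, h₂⟩ := hdesc (𝟙 _) (𝟙 _) rfl
    exact (h₁ x).symm.trans ((congrArg (fn u) e).trans (h₂ y))
  have hmem : ∀ x : X, fn c.inl x = fn c.inr x → x ∈ Set.range f := fun x e => by
    by_contra hx
    obtain ⟨u, h₁, h₂⟩ := hdesc (T := sierpinskiQCB0)
      (ofHom (fun y : X => y ≠ x) (continuous_Prop.2 isOpen_ne)) (const (Y := sierpinskiQCB0) True)
      (hom_ext fun y => eq_true fun h => hx ⟨y, h⟩)
    exact of_eq_true ((h₁ x).symm.trans ((congrArg (fn u) e).trans (h₂ x))) rfl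
  have hs : ∀ (s : PullbackCone c.inl c.inr) z, (fn s.fst z : X) = fn s.snd z := fun s z =>
    heq _ _ (congr_fn s.condition z)
  have hsm : ∀ (s : PullbackCone c.inl c.inr) z, fn s.fst z ∈ Set.range f := fun s z =>
    hmem _ ((congr_fn s.condition z).trans (congrArg (fn c.inr) (hs s z).symm))
  exact hP.pullback_mem hX hX hcP
    (c := PullbackCone.mk (f := c.inl) (g := c.inr) (W := cb (Set.range f))
      (ofHom Subtype.val continuous_subtype_val)
      (ofHom Subtype.val continuous_subtype_val)
      (hom_ext fun ⟨_, y, e⟩ => e ▸ congr_fn c.condition y))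
    (PullbackCone.IsLimit.mk _
      (fun s => ofHom (fun z => (⟨fn s.fst z, hsm s z⟩ : Set.range f))
        ((continuous_fn s.fst).subtype_mk _))
      (fun _ => rfl) (fun s => hom_ext fun z => hs s z)
      fun s m h₁ _ => hom_ext fun z => Subtype.ext (congr_fn h₁ z))

end InheritsFiniteStructure

/-! ### Minimality: projective sets, then projective spaces -/

namespace InheritsFiniteStructure

variable {P : ObjectProperty QCB0} (hP : InheritsFiniteStructure P)

include hP

theorem cb_baire (hω : P.isoClosure omegaQCB0) : P.isoClosure (cb Baire) := by
  obtain ⟨E, hE, h⟩ := hP.exists_exponential hω hω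
  obtain ⟨e⟩ := QCB0.IsExponential.nonempty_iso h isExponential_baire
  exact P.isoClosure.prop_of_iso e hE

theorem cb_of_isSigmaOne (hS : P.isoClosure sierpinskiQCB0) (hω : P.isoClosure omegaQCB0) (n : ℕ) :
    ∀ (X : Type) [TopologicalSpace X] [T2Space X] [SecondCountableTopology X],
      P.isoClosure (cb X) → ∀ {A : Set X}, IsSigmaOne n X A → P.isoClosure (cb A) := by
  have hB := hP.cb_baire hω
  induction n with
  | zero =>
    rintro X _ _ _ hX A ⟨U, V, hU, hV, rfl⟩
    -- A countable union becomes a projection from `Baire × X`, with the index read off as the entry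
    -- at `0`; the difference is a complement inside the open subspace given by the `U i`.
    have hopen : ∀ U : ℕ → Set X, (∀ i, IsOpen (U i)) →
        IsOpen {t : Baire × X | t.2 ∈ U (t.1 0)} := fun U hU => by
      have : {t : Baire × X | t.2 ∈ U (t.1 0)} = ⋃ n, {t | t.1 0 = n} ∩ {t | t.2 ∈ U n} := by
        ext t; simp
      rw [this]
      exact isOpen_iUnion fun n => ((isOpen_discrete {n}).preimage
        (f := fun t : Baire × X => t.1 0) (by fun_prop)).inter ((hU n).preimage continuous_snd)
    have h₁ := hP.cb_of_isOpen hS (hP.cb_prod hB hX) (hopen U hU)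
    have h₂ := hP.cb_compl hS h₁
      (hP.cb_of_isOpen hS h₁ ((hopen V hV).preimage continuous_subtype_val))
    refine cb_of_homeomorph (Homeomorph.setCongr ?_) (hP.cb_range hX h₂
      (f := fun t => t.1.1.2) (by fun_prop))
    ext x
    simp only [Set.mem_range, Set.mem_iUnion]
    constructor
    · rintro ⟨⟨⟨t, ht⟩, ht'⟩, rfl⟩
      exact ⟨_, ht, ht'⟩
    · rintro ⟨i, hi, hi'⟩
      exact ⟨⟨⟨(fun _ => i, x), hi⟩, hi'⟩, rfl⟩
  | succ n ih =>
    rintro X _ _ _ hX A ⟨B, hBn, rfl⟩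
    have hBX := hP.cb_prod hB hX
    refine cb_of_homeomorph (Homeomorph.setCongr ?_) (hP.cb_range hX
      (hP.cb_compl hS hBX (ih _ hBX hBn)) (f := fun t => t.1.2) (by fun_prop))
    ext x
    exact ⟨fun ⟨t, e⟩ => ⟨t.1.1, by rw [← e]; exact t.2⟩, fun ⟨p, hp⟩ => ⟨⟨(p, x), hp⟩, rfl⟩⟩

theorem projectiveQCB0_le (hS : P.isoClosure sierpinskiQCB0) (hω : P.isoClosure omegaQCB0) :
    projectiveQCB0 ≤ P.isoClosure := by
  rintro X ⟨n, D, δ, hδ, hn⟩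
  have hB := hP.cb_baire hω
  have hR : P.isoClosure (cb (EQ δ)) := hP.cb_of_isSigmaOne hS hω n _ (hP.cb_prod hB hB) hn
  -- Since `EQ δ` contains the diagonal of `D`, its first projection is `D`.
  have hD : P.isoClosure (cb D) := by
    refine cb_of_homeomorph (Homeomorph.setCongr ?_) (hP.cb_range hB hR
      (f := fun t => t.1.1) (by fun_prop))
    ext x
    exact ⟨fun ⟨t, e⟩ => e ▸ t.2.1, fun hx => ⟨⟨(x, x), hx, hx, rfl⟩, rfl⟩⟩
  have hq := hδ.isQuotientMap X.2
  let f : cb (EQ δ) ⟶ cb D := ofHom (fun t => ⟨t.1.1, t.2.1⟩)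
    ((continuous_fst.comp continuous_subtype_val).subtype_mk _)
  let g : cb (EQ δ) ⟶ cb D := ofHom (fun t => ⟨t.1.2, t.2.2.1⟩)
    ((continuous_snd.comp continuous_subtype_val).subtype_mk _)
  let q : cb D ⟶ X := ofHom δ hδ.continuous
  -- Applied to pairs `(p, p)`, this also forces the two legs of the cocone to agree, so the pushout
  -- is the coequalizer of the two projections.
  have hs : ∀ (s : PushoutCocone f g) (p p' : D), δ p = δ p' → fn s.inl p = fn s.inr p' :=
    fun s p p' e => congr_fn s.condition (⟨(p, p'), p.2, p'.2, e⟩ : EQ δ)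
  have hu : ∀ s : PushoutCocone f g, ∃ u : X ⟶ s.pt, ∀ p : D, fn u (δ p) = fn s.inl p := fun s => by
    choose a ha using hδ.surjective
    have key : ∀ p : D, fn s.inl (a (δ p)) = fn s.inl p := fun p =>
      (hs s _ _ (ha _)).trans (hs s p p rfl).symm
    exact ⟨ofHom (fun x => fn s.inl (a x)) (hq.continuous_iff.2 (by
      rw [show (fun x => fn s.inl (a x)) ∘ δ = fn s.inl from funext key]
      exact continuous_fn s.inl)), key⟩
  choose u hu using hu
  exact hP.pushout_mem hD hD hR
    (c := PushoutCocone.mk (f := f) (g := g) q q (hom_ext fun t => t.2.2.2))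
    (PushoutCocone.IsColimit.mk _ u (fun s => hom_ext (hu s))
      (fun s => hom_ext fun p => (hu s p).trans (hs s p p rfl))
      fun s m h₁ _ => hom_ext fun x => by
        obtain ⟨p, rfl⟩ := hδ.surjective x
        exact (congr_fn h₁ p).trans (hu s p).symm)

end InheritsFiniteStructure

theorem theorem7p5 :
    (InheritsFiniteStructure projectiveQCB0 ∧
      projectiveQCB0 sierpinskiQCB0 ∧ projectiveQCB0 omegaQCB0 ∧
      projectiveQCB0.IsClosedUnderIsomorphisms) ∧
    ∀ P : ObjectProperty QCB0,
      InheritsFiniteStructure P → P.isoClosure sierpinskiQCB0 → P.isoClosure omegaQCB0 →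
        projectiveQCB0 ≤ P.isoClosure :=
  ⟨⟨inheritsFiniteStructure_projectiveQCB0, projectiveQCB0_iff.2 isProjectiveSpace_prop,
    projectiveQCB0_iff.2 isProjectiveSpace_nat, inferInstance⟩,
    fun _ hP hS hω => hP.projectiveQCB0_le hS hω⟩
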